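/- Let $M$ be a smooth manifold (Hausdorff, second countable) of dimension $n$, let $(\varphi^t)_{t\in\mathbb R}$ be a complete $C^\infty$ flow on $M$ generated by a nowhere-vanishing vector field $X$, and let $r\in\{1,2,\dots\}\cup\{\infty\}$. A *foliation of $M$ of dimension $k$ with $C^r$ leaves* is a partition $\mathcal F$ of $M$ into connected injectively immersed $C^r$ submanifolds $L$ of dimension $k$ such that every point of $M$ lies in the domain $U$ of a homeomorphism $\psi:U\to U^1\times U^2$, with $U\subset M$ open and $U^1\subset\mathbb R^k$, $U^2\subset\mathbb R^{n-k}$ connected and open, having the following property: for every leaf $L$ and every connected component $C$ of $U\cap L$ (in the topology of $L$) there is $c\in\mathbb R^{n-k}$ with $\psi(C)=U^1\times\{c\}$, and $\mathrm{pr}_1\circ\psi|_C:C\to U^1$ is a $C^r$ chart of $L$. Write $\mathcal F_x$ for the leaf through $x$ and $T_x\mathcal F=T_x(\mathcal F_x)\subset T_xM$. The foliation is called *continuous* (or integral) if $T\mathcal F=\bigcup_xT_x\mathcal F$ is a continuous subbundle of $TM$. Let $\mathcal F$ be a continuous foliation of $M$ of dimension $k$ with $C^r$ leaves which is invariant under the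 flow, i.e. $\varphi^t(\mathcal F_x)=\mathcal F_{\varphi^t(x)}$ for all $t\in\mathbb R$ and $x\in M$, and such that $X$ is nowhere tangent to $\mathcal F$, i.e. $X(x)\notin T_x\mathcal F$ for all $x\in M$. Then there exists a continuous foliation $\mathcal F^w$ of $M$ of dimension $k+1$ with $C^r$ leaves such that, for every $x\in M$, the leaf of $\mathcal F^w$ through $x$ is $\mathcal F^w_x=\bigcup_{t\in\mathbb R}\varphi^t(\mathcal F_x)$, and $T_x\mathcal F^w=T_x\mathcal F\oplus\mathbb R X(x)$. -/

import Mathlib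

open scoped Manifold ContDiff

universe u

/-- An (injectively) immersed `C^r` submanifold of dimension `k` of the `n`-manifold `M`: a
(Hausdorff, second countable) `C^r` manifold `Pt` of dimension `k`, with its own topology, together
with an injective `C^r` immersion `incl` into `M`. As a set, the submanifold is the range of
`incl`. -/
structure ImmersedSubmanifold (r : ℕ∞) (k n : ℕ) (M : Type u) [TopologicalSpace M]
    [ChartedSpace (EuclideanSpace ℝ (Fin n)) M] where
  Pt : Type u
  [topology : TopologicalSpace Pt]
  [chartedSpace : ChartedSpace (EuclideanSpace ℝ (Fin k)) Pt]
  [isManifold : IsManifold (𝓡 k) r Pt]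
  [t2Space : T2Space Pt]
  [secondCountable : SecondCountableTopology Pt]
  incl : Pt → M
  injective_incl : Function.Injective incl
  contMDiff_incl : ContMDiff (𝓡 k) (𝓡 n) r incl
  injective_mfderiv : ∀ p, Function.Injective (mfderiv (𝓡 k) (𝓡 n) incl p)

attribute [instance] ImmersedSubmanifold.topology ImmersedSubmanifold.chartedSpace
  ImmersedSubmanifold.isManifold ImmersedSubmanifold.t2Space ImmersedSubmanifold.secondCountable

/-- The `C^0` chart `ψ : U → U₁ × U₂` of `M` is a foliated chart for the family of immersed
submanifolds `leaf`: each connected component `C` of `U ∩ L` (for the topology of the leaf `L`;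
it is given here as the component of one of its points `p`) is mapped by `ψ` onto some
`U₁ × {c}`, and the first component of `ψ` restricts to a `C^r` chart of `L` with domain `C`. -/
structure IsFoliatedChart {r : ℕ∞} {k n : ℕ} {M : Type u} [TopologicalSpace M]
    [ChartedSpace (EuclideanSpace ℝ (Fin n)) M] {ι : Type u}
    (leaf : ι → ImmersedSubmanifold r k n M)
    (ψ : OpenPartialHomeomorph M
      (EuclideanSpace ℝ (Fin k) × EuclideanSpace ℝ (Fin (n - k))))
    (U₁ : Set (EuclideanSpace ℝ (Fin k))) (U₂ : Set (EuclideanSpace ℝ (Fin (n - k)))) : Prop where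
  isOpen_fst : IsOpen U₁
  isOpen_snd : IsOpen U₂
  isConnected_fst : IsConnected U₁
  isConnected_snd : IsConnected U₂
  target_eq : ψ.target = U₁ ×ˢ U₂
  plaque : ∀ (a : ι) (p : (leaf a).Pt), (leaf a).incl p ∈ ψ.source →
    (∃ c : EuclideanSpace ℝ (Fin (n - k)),
      (fun q => ψ ((leaf a).incl q)) '' connectedComponentIn ((leaf a).incl ⁻¹' ψ.source) p
        = U₁ ×ˢ {c}) ∧
    ∃ e ∈ IsManifold.maximalAtlas (𝓡 k) r (leaf a).Pt,
      e.source = connectedComponentIn ((leaf a).incl ⁻¹' ψ.source) p ∧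
      ∀ q ∈ e.source, e q = (ψ ((leaf a).incl q)).1

/-- A (topological) foliation of dimension `k` with `C^r` leaves of the `n`-manifold `M`: a
partition of `M` into connected immersed `C^r` submanifolds of dimension `k`, such that every
point of `M` lies in a foliated chart. -/
structure Foliation (r : ℕ∞) (k n : ℕ) (M : Type u) [TopologicalSpace M]
    [ChartedSpace (EuclideanSpace ℝ (Fin n)) M] where
  ι : Type u
  leaf : ι → ImmersedSubmanifold r k n M
  connectedSpace_leaf : ∀ a, ConnectedSpace (leaf a).Pt
  existsUnique_leaf : ∀ x : M, ∃! a, x ∈ Set.range (leaf a).incl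
  exists_chart : ∀ x : M, ∃ ψ U₁ U₂, x ∈ ψ.source ∧ IsFoliatedChart leaf ψ U₁ U₂

namespace Foliation

variable {r : ℕ∞} {k n : ℕ} {M : Type u} [TopologicalSpace M]
  [ChartedSpace (EuclideanSpace ℝ (Fin n)) M] (F : Foliation r k n M)

/-- The index of the leaf containing `x`. -/
noncomputable def leafIndex (x : M) : F.ι := (F.existsUnique_leaf x).choose

/-- The point `x`, seen as a point of the leaf that contains it. -/
noncomputable def leafPoint (x : M) : (F.leaf (F.leafIndex x)).Pt :=
  (F.existsUnique_leaf x).choose_spec.1.choose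

theorem incl_leafPoint (x : M) : (F.leaf (F.leafIndex x)).incl (F.leafPoint x) = x :=
  (F.existsUnique_leaf x).choose_spec.1.choose_spec

/-- The leaf `F_x` through `x`, as a subset of `M`. -/
def leafThrough (x : M) : Set M := Set.range (F.leaf (F.leafIndex x)).incl

/-- The fibre `T_x F` at `x` of the tangent bundle of the foliation: the tangent space at `x` of
the leaf through `x`, that is, the range of the differential of the inclusion of the leaf. -/
noncomputable def tangentSpace (x : M) : Submodule ℝ (TangentSpace (𝓡 n) x) :=
  F.incl_leafPoint x ▸
    (mfderiv (𝓡 k) (𝓡 n) (F.leaf (F.leafIndex x)).incl (F.leafPoint x)).range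

theorem leafIndex_incl (a : F.ι) (p : (F.leaf a).Pt) : F.leafIndex ((F.leaf a).incl p) = a :=
  (F.existsUnique_leaf _).unique ⟨_, F.incl_leafPoint _⟩ ⟨p, rfl⟩

theorem tangentSpace_incl (a : F.ι) (p : (F.leaf a).Pt) :
    F.tangentSpace ((F.leaf a).incl p) = (mfderiv (𝓡 k) (𝓡 n) (F.leaf a).incl p).range := by
  have key : ∀ (b : F.ι) (q : (F.leaf b).Pt) (h : (F.leaf b).incl q = (F.leaf a).incl p),
      (h ▸ (mfderiv (𝓡 k) (𝓡 n) (F.leaf b).incl q).range :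
        Submodule ℝ (TangentSpace (𝓡 n) ((F.leaf a).incl p)))
      = (mfderiv (𝓡 k) (𝓡 n) (F.leaf a).incl p).range := by
    intro b q h
    obtain rfl : b = a := (F.existsUnique_leaf _).unique ⟨q, h⟩ ⟨p, rfl⟩
    obtain rfl : q = p := (F.leaf b).injective_incl h
    rfl
  exact key _ _ (F.incl_leafPoint _)

end Foliation

/-- A family `D` of subspaces of the tangent spaces of `M` is a continuous subbundle of rank `k`
of `TM`: around every point it has a continuous local frame of `k` vector fields. -/
def IsContinuousSubbundle {n : ℕ} {M : Type u} [TopologicalSpace M]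
    [ChartedSpace (EuclideanSpace ℝ (Fin n)) M] [IsManifold (𝓡 n) ∞ M] (k : ℕ)
    (D : ∀ x : M, Submodule ℝ (TangentSpace (𝓡 n) x)) : Prop :=
  ∀ x₀ : M, ∃ U : Set M, IsOpen U ∧ x₀ ∈ U ∧
    ∃ s : Fin k → ∀ x : M, TangentSpace (𝓡 n) x,
      (∀ i, ContinuousOn (fun x => (⟨x, s i x⟩ : TangentBundle (𝓡 n) M)) U) ∧
      ∀ x ∈ U, LinearIndependent ℝ (fun i => s i x) ∧
        Submodule.span ℝ (Set.range fun i => s i x) = D x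

/-- A continuous (or integral, or `C^0`) foliation: its tangent bundle `TF` is a continuous
subbundle of `TM`. -/
def Foliation.IsIntegral {r : ℕ∞} {k n : ℕ} {M : Type u} [TopologicalSpace M]
    [ChartedSpace (EuclideanSpace ℝ (Fin n)) M] [IsManifold (𝓡 n) ∞ M]
    (F : Foliation r k n M) : Prop :=
  IsContinuousSubbundle k F.tangentSpace

/-! A weak leaf is parametrized by `(t, p) ↦ φ t p` on `ℝ × L`, with `L` a leaf of `F`. Up to the
isomorphism given by the differential of `φ t`, the differential of this map is `(s, w) ↦ s • X +
w`, which is injective because `X` is transverse to `F`. Two points with the same image differ by a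
flow map carrying `L` to itself, so the quotient of `ℝ × L` by the kernel of the map is an open
quotient. It is a manifold with an injective immersion into `M`. That flow maps are continuous
between leaves, for the leaf topologies, rests on countability: a leaf meets a foliated chart in
countably many plaques, so a connected piece of it inside the chart stays in one plaque
(`Foliation.continuous_of_continuous_incl`).

The main work is to find foliated charts, because the charts of `F` are only continuous and the
inverse function theorem does not apply to them. Take flow box coordinates `(τ, α, β)` in which the
flow translates `τ` and `dα` is injective on `TF` (`nonempty_flowBox`); injectivity near the base
point is where the continuity of `TF` enters the construction of charts. Then `α` can replace the
plaque coordinate of a foliated chart of `F`. This rests on a topological fact about continuous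
families of local homeomorphisms (`exists_openPartialHomeomorph_prodMk_snd`). Let `π` slide a point
along its plaque to `α = 0`. The flow preserves plaques and `α`, hence commutes with `π` for small
times, and `β ∘ π` is constant both along plaques and along orbits. The map `(τ, α, β ∘ π)` is the
chart sought (`exists_saturated_chart`); its inverse is written down explicitly, so only continuity
has to be checked.

The tangent space of a weak leaf contains `TF` and `X`, and equals their sum by dimension. Adjoining
`X` to a continuous frame of `TF` gives a continuous frame of it. -/

/-! ### Local inverses of immersions -/

section LeftInverse

open Filter Topology Set

/-- With `π` a linear left inverse of the derivative at `p`, the map `π ∘ f` has derivative `id`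
there, and `l` is its local inverse composed with `π`. Smoothness is asked near `p` because for `s =
∞` smoothness at `p` alone provides no neighbourhood on which `f` is `C^∞`. -/
theorem exists_eventually_contDiffAt_leftInverse {E F : Type*} [NormedAddCommGroup E]
    [NormedSpace ℝ E] [FiniteDimensional ℝ E] [NormedAddCommGroup F] [NormedSpace ℝ F]
    [FiniteDimensional ℝ F] {s : WithTop ℕ∞} (hs : s ≠ 0) {f : E → F} {p : E}
    (hf : ∀ᶠ q in 𝓝 p, ContDiffAt ℝ s f q) (hinj : Function.Injective (fderiv ℝ f p)) :
    ∃ l : F → E, (∀ᶠ z in 𝓝 (f p), ContDiffAt ℝ s l z) ∧ ∀ᶠ q in 𝓝 p, l (f q) = q := by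
  have : CompleteSpace E := FiniteDimensional.complete ℝ E
  obtain ⟨π₀, hπ₀⟩ := (fderiv ℝ f p).toLinearMap.exists_leftInverse_of_injective
    (LinearMap.ker_eq_bot.2 hinj)
  set π : F →L[ℝ] E := π₀.toContinuousLinearMap
  have hπ : π.comp (fderiv ℝ f p) = ContinuousLinearMap.id ℝ E := by
    ext v; exact LinearMap.congr_fun hπ₀ v
  have hg : ∀ᶠ q in 𝓝 p, ContDiffAt ℝ s (fun q => π (f q)) q := by
    filter_upwards [hf] with q hq using π.contDiff.contDiffAt.comp q hq
  have hfp := hf.self_of_nhds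
  have hgp := hg.self_of_nhds
  have hd : ∀ q, ContDiffAt ℝ s f q → fderiv ℝ (fun q => π (f q)) q = π.comp (fderiv ℝ f q) :=
    fun q hq => (π.hasFDerivAt.comp q (hq.differentiableAt hs).hasFDerivAt).fderiv
  have hg' : HasFDerivAt (fun q => π (f q))
      ((ContinuousLinearEquiv.refl ℝ E : E ≃L[ℝ] E) : E →L[ℝ] E) p := by
    have := (hgp.differentiableAt hs).hasFDerivAt
    rwa [hd p hfp, hπ] at this
  set e := hgp.toOpenPartialHomeomorph _ hg' hs
  have he : ∀ q, e q = π (f q) := fun q => rfl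
  have hpe : p ∈ e.source := hgp.mem_toOpenPartialHomeomorph_source hg' hs
  have hpt : e p ∈ e.target := e.map_source hpe
  have hcont : ContinuousAt (fderiv ℝ (fun q => π (f q))) p :=
    (hgp.of_le (ENat.one_le_iff_ne_zero_withTop.2 hs)).continuousAt_fderiv (by simp)
  -- Invertible derivatives form an open set, so the inverse is `C^s` at all points near `f p` and
  -- not only at `f p`.
  have hinv : ∀ᶠ q in 𝓝 p, fderiv ℝ (fun q => π (f q)) q ∈
      range ((↑) : (E ≃L[ℝ] E) → (E →L[ℝ] E)) :=
    hcont.eventually_mem (by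
      rw [hg'.fderiv]; exact ContinuousLinearEquiv.nhds (ContinuousLinearEquiv.refl ℝ E))
  have hsymm : ∀ᶠ z in 𝓝 (e p), ContDiffAt ℝ s e.symm z := by
    have h1 : Tendsto e.symm (𝓝 (e p)) (𝓝 p) := by
      have := e.continuousAt_symm hpt
      rwa [ContinuousAt, e.left_inv hpe] at this
    filter_upwards [h1.eventually hinv, h1.eventually hg, e.open_target.mem_nhds hpt]
      with z ⟨A, hA⟩ hz hzt
    refine e.contDiffAt_symm hzt (f₀' := A) ?_ hz
    rw [hA]
    exact (hz.differentiableAt hs).hasFDerivAt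
  refine ⟨fun z => e.symm (π z), ?_, ?_⟩
  · have h2 : Tendsto π (𝓝 (f p)) (𝓝 (e p)) := π.continuous.tendsto _
    filter_upwards [h2.eventually hsymm] with z hz using hz.comp z π.contDiff.contDiffAt
  · filter_upwards [e.open_source.mem_nhds hpe] with q hq using e.left_inv hq

theorem injective_mfderiv_of_eventually_leftInverse {𝕜 E H N E' H' M : Type*}
    [NontriviallyNormedField 𝕜] [NormedAddCommGroup E] [NormedSpace 𝕜 E] [TopologicalSpace H]
    {I : ModelWithCorners 𝕜 E H} [TopologicalSpace N] [ChartedSpace H N] [NormedAddCommGroup E']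
    [NormedSpace 𝕜 E'] [TopologicalSpace H'] {J : ModelWithCorners 𝕜 E' H'} [TopologicalSpace M]
    [ChartedSpace H' M] {f : N → M} {g : M → N} {p : N} (hf : MDifferentiableAt I J f p)
    (hg : MDifferentiableAt J I g (f p)) (hgf : ∀ᶠ q in 𝓝 p, g (f q) = q) :
    Function.Injective (mfderiv I J f p) := by
  have h1 : mfderiv I I (g ∘ f) p = (mfderiv J I g (f p)).comp (mfderiv I J f p) :=
    mfderiv_comp p hg hf
  have h2 : g ∘ f =ᶠ[𝓝 p] id := hgf
  rw [h2.mfderiv_eq, mfderiv_id] at h1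
  intro a b hab
  have ha := DFunLike.congr_fun h1 a
  have hb := DFunLike.congr_fun h1 b
  exact ha.trans ((congrArg (mfderiv J I g (f p)) hab).trans hb.symm)

variable {m n : ℕ} {N : Type*} [TopologicalSpace N] [ChartedSpace (EuclideanSpace ℝ (Fin m)) N]
  {M : Type*} [TopologicalSpace M] [ChartedSpace (EuclideanSpace ℝ (Fin n)) M]
  {s : WithTop ℕ∞} [IsManifold (𝓡 m) s N] [IsManifold (𝓡 n) s M]

theorem exists_eventually_contMDiffAt_leftInverse (hs : s ≠ 0) {f : N → M} {p : N}
    (hf : ∀ᶠ q in 𝓝 p, ContMDiffAt (𝓡 m) (𝓡 n) s f q)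
    (hinj : Function.Injective (mfderiv (𝓡 m) (𝓡 n) f p)) :
    ∃ l : M → N, (∀ᶠ z in 𝓝 (f p), ContMDiffAt (𝓡 n) (𝓡 m) s l z) ∧
      ∀ᶠ q in 𝓝 p, l (f q) = q := by
  have hfp := hf.self_of_nhds
  set cN := extChartAt (𝓡 m) p
  set cM := extChartAt (𝓡 n) (f p)
  set g := fun u => cM (f (cN.symm u)) with hg_def
  have hpN : p ∈ cN.source := mem_extChartAt_source p
  have hcNt : cN.target ∈ 𝓝 (cN p) := extChartAt_target_mem_nhds p
  have hcNs : Tendsto cN.symm (𝓝 (cN p)) (𝓝 p) := by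
    have := continuousAt_extChartAt_symm (I := 𝓡 m) p
    rwa [ContinuousAt, extChartAt_to_inv] at this
  have hcN : Tendsto cN (𝓝 p) (𝓝 (cN p)) := continuousAt_extChartAt p
  have hcM : Tendsto cM (𝓝 (f p)) (𝓝 (cM (f p))) := continuousAt_extChartAt (f p)
  have hsN : cN.source ∈ 𝓝 p := extChartAt_source_mem_nhds p
  have hsM : cM.source ∈ 𝓝 (f p) := extChartAt_source_mem_nhds (f p)
  have hg : ∀ᶠ u in 𝓝 (cN p), ContDiffAt ℝ s g u := by
    filter_upwards [hcNt, hcNs.eventually hf,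
      hcNs.eventually (hfp.continuousAt.eventually hsM)] with u hu hfu hMu
    rw [← contMDiffAt_iff_contDiffAt]
    have h1 : ContMDiffAt 𝓘(ℝ, EuclideanSpace ℝ (Fin m)) (𝓡 m) s cN.symm u :=
      (contMDiffOn_extChartAt_symm p).contMDiffAt
        ((isOpen_extChartAt_target (I := 𝓡 m) p).mem_nhds hu)
    have h2 : ContMDiffAt (𝓡 n) 𝓘(ℝ, EuclideanSpace ℝ (Fin n)) s cM (f (cN.symm u)) :=
      contMDiffAt_extChartAt' (by rwa [← extChartAt_source (𝓡 n)])
    exact h2.comp u (hfu.comp u h1)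
  have hgd : fderiv ℝ g (cN p) = mfderiv (𝓡 m) (𝓡 n) f p := by
    refine Eq.trans ?_ (hfp.mdifferentiableAt hs).mfderiv.symm
    rw [ModelWithCorners.range_eq_univ, fderivWithin_univ]
    rfl
  obtain ⟨l, hl, hlg⟩ := exists_eventually_contDiffAt_leftInverse hs hg
    (by rw [hgd]; exact hinj)
  have hgp : g (cN p) = cM (f p) := by simp only [hg_def]; rw [cN.left_inv hpN]
  rw [hgp] at hl
  have hlp : l (cM (f p)) = cN p := by rw [← hgp]; exact hlg.self_of_nhds
  refine ⟨fun z => cN.symm (l (cM z)), ?_, ?_⟩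
  · have hlt : Tendsto l (𝓝 (cM (f p))) (𝓝 (cN p)) := by
      have := hl.self_of_nhds.continuousAt
      rwa [ContinuousAt, hlp] at this
    filter_upwards [hsM, hcM.eventually hl, hcM.eventually (hlt.eventually hcNt)] with z hz hlz ht
    have h1 : ContMDiffAt 𝓘(ℝ, EuclideanSpace ℝ (Fin m)) (𝓡 m) s cN.symm (l (cM z)) :=
      (contMDiffOn_extChartAt_symm p).contMDiffAt
        ((isOpen_extChartAt_target (I := 𝓡 m) p).mem_nhds ht)
    have h2 : ContMDiffAt (𝓡 n) 𝓘(ℝ, EuclideanSpace ℝ (Fin n)) s cM z :=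
      contMDiffAt_extChartAt' (by rwa [← extChartAt_source (𝓡 n)])
    exact h1.comp z ((contMDiffAt_iff_contDiffAt.2 hlz).comp z h2)
  · filter_upwards [hsN, hcN.eventually hlg] with q hq hlq
    simp only [hg_def, cN.left_inv hq] at hlq
    rw [hlq, cN.left_inv hq]

/-- A continuous map whose composition with an immersion is `C^s` is itself `C^s`. -/
theorem ContMDiffAt.of_comp_immersion (hs : s ≠ 0) {G H Y : Type*} [NormedAddCommGroup G]
    [NormedSpace ℝ G] [TopologicalSpace H] {J : ModelWithCorners ℝ G H} [TopologicalSpace Y]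
    [ChartedSpace H Y] {f : N → M} {h : Y → N} {y : Y}
    (hf : ∀ᶠ q in 𝓝 (h y), ContMDiffAt (𝓡 m) (𝓡 n) s f q)
    (hinj : Function.Injective (mfderiv (𝓡 m) (𝓡 n) f (h y))) (hh : ContinuousAt h y)
    (hfh : ContMDiffAt J (𝓡 n) s (fun y => f (h y)) y) : ContMDiffAt J (𝓡 m) s h y := by
  obtain ⟨l, hl, hlf⟩ := exists_eventually_contMDiffAt_leftInverse hs hf hinj
  refine (hl.self_of_nhds.comp y hfh).congr_of_eventuallyEq ?_
  filter_upwards [hh.eventually hlf] with z hz using hz.symm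

/-- The inverse function theorem for manifolds of the same dimension. -/
theorem exists_eventually_contMDiffAt_inverse {M' : Type*} [TopologicalSpace M']
    [ChartedSpace (EuclideanSpace ℝ (Fin n)) M'] [IsManifold (𝓡 n) s M'] (hs : s ≠ 0)
    {f : M' → M} {p : M'}
    (hf : ∀ᶠ q in 𝓝 p, ContMDiffAt (𝓡 n) (𝓡 n) s f q)
    (hinj : Function.Injective (mfderiv (𝓡 n) (𝓡 n) f p)) :
    ∃ l : M → M', (∀ᶠ z in 𝓝 (f p), ContMDiffAt (𝓡 n) (𝓡 n) s l z) ∧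
      (∀ᶠ q in 𝓝 p, l (f q) = q) ∧ ∀ᶠ z in 𝓝 (f p), f (l z) = z := by
  obtain ⟨l, hl, hlf⟩ := exists_eventually_contMDiffAt_leftInverse hs hf hinj
  have hlp : l (f p) = p := hlf.self_of_nhds
  have hfp := hf.self_of_nhds
  have hcomp : (mfderiv (𝓡 n) (𝓡 n) l (f p)).comp (mfderiv (𝓡 n) (𝓡 n) f p) =
      ContinuousLinearMap.id ℝ (TangentSpace (𝓡 n) p) := by
    rw [← mfderiv_comp p (hl.self_of_nhds.mdifferentiableAt hs) (hfp.mdifferentiableAt hs),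
      ← mfderiv_id]
    exact Filter.EventuallyEq.mfderiv_eq hlf
  have hlinj : Function.Injective (mfderiv (𝓡 n) (𝓡 n) l (f p)) := by
    have h1 : Function.Surjective (mfderiv (𝓡 n) (𝓡 n) l (f p)) := fun v =>
      ⟨mfderiv (𝓡 n) (𝓡 n) f p v, DFunLike.congr_fun hcomp v⟩
    have h2 : ∀ A : EuclideanSpace ℝ (Fin n) →L[ℝ] EuclideanSpace ℝ (Fin n),
        Function.Surjective A → Function.Injective A := fun A =>
      (LinearMap.injective_iff_surjective (f := A.toLinearMap)).2
    exact h2 _ h1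
  -- By equality of dimensions `l` is also an immersion and has a left inverse `k`. Near `p` one
  -- gets `f = k ∘ l ∘ f = k`, so `f ∘ l = k ∘ l = id`.
  obtain ⟨k, hk, hkl⟩ := exists_eventually_contMDiffAt_leftInverse hs hl hlinj
  refine ⟨l, hl, hlf, ?_⟩
  rw [hlp] at hk
  have hlt : Tendsto l (𝓝 (f p)) (𝓝 p) := by
    have := hl.self_of_nhds.continuousAt
    rwa [ContinuousAt, hlp] at this
  have hfk : ∀ᶠ q in 𝓝 p, f q = k q := by
    filter_upwards [hlf, hfp.continuousAt.eventually hkl] with q h1 h2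
    rw [← h2, h1]
  filter_upwards [hkl, hlt.eventually hfk] with z h1 h2
  rw [h2, h1]

end LeftInverse

/-! ### Continuous families of local homeomorphisms -/

section LocalHomeomorph

open Filter Topology Set Metric

/-- A map on a closed ball that is a local homeomorphism in the interior and maps the boundary
outside of a ball `B` is injective on connected sets mapped into `B`. -/
theorem injOn_of_isLocalHomeomorphOn {E : Type*} [NormedAddCommGroup E] [NormedSpace ℝ E]
    {K : Set E} (hK : IsCompact K) {g : E → E} (hg : ContinuousOn g K) {y : E} {δ : ℝ}
    (hloc : ∀ u ∈ K, g u ∈ ball y δ →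
      K ∈ 𝓝 u ∧ ∃ e : OpenPartialHomeomorph E E, u ∈ e.source ∧ EqOn g e e.source)
    {V : Set E} (hV : IsPreconnected V) (hVK : V ⊆ K) (hVB : MapsTo g V (ball y δ)) :
    InjOn g V := by
  have : CompactSpace K := isCompact_iff_compactSpace.1 hK
  have hgK : Continuous (K.domRestrict g) := hg.domRestrict
  have hL : IsLocalHomeomorphOn (K.domRestrict g) (K.domRestrict g ⁻¹' ball y δ) := by
    have hval : IsLocalHomeomorphOn (Subtype.val : K → E)
        (Subtype.val ⁻¹' interior K : Set K) := by
      rw [isLocalHomeomorphOn_iff_isOpenEmbedding_restrict]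
      intro w hw
      have ho : IsOpen (Subtype.val ⁻¹' interior K : Set K) :=
        isOpen_interior.preimage continuous_subtype_val
      refine ⟨_, ho.mem_nhds hw, IsEmbedding.subtypeVal.comp IsEmbedding.subtypeVal, ?_⟩
      convert! isOpen_interior (s := K)
      ext v
      simp only [domRestrict_eq, range_comp, Subtype.range_coe, Subtype.image_preimage_coe]
      exact ⟨fun h => h.2, fun h => ⟨interior_subset h, h⟩⟩
    have hgl : IsLocalHomeomorphOn g {u | u ∈ K ∧ g u ∈ ball y δ} :=
      IsLocalHomeomorphOn.mk _ _ fun u hu => (hloc u hu.1 hu.2).2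
    refine (hgl.comp (hval.mono fun u hu => ?_) fun u hu => ⟨u.2, hu⟩)
    exact mem_interior_iff_mem_nhds.2 (hloc u u.2 hu).1
  -- Compactness of `K` makes a local homeomorphism over the ball a covering over the ball.
  have hcov : IsCoveringMapOn (K.domRestrict g) (ball y δ) :=
    IsCoveringMapOn.of_isLocalHomeomorphOn hgK hL
  intro u hu u' hu' huu
  let B := ball y δ
  have hBo : IsOpen B := isOpen_ball
  have hBc : Convex ℝ B := convex_ball y δ
  have : ContractibleSpace B := hBc.contractibleSpace ⟨g u, hVB hu⟩
  have : LocallyPathConnectedSpace B := hBo.locallyPathConnectedSpace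
  -- The ball is contractible, so the covering has a section `s` through `u`. Uniqueness of lifts on
  -- the connected set `V` gives `s ∘ g = id` there, hence injectivity.
  obtain ⟨s, ⟨hs₀, hs⟩, -⟩ := hcov.existsUnique_continuousMap_lifts
    (⟨Subtype.val, continuous_subtype_val⟩ : C(B, E)) (a₀ := ⟨g u, hVB hu⟩)
    (e₀ := ⟨u, hVK hu⟩) rfl (fun a => a.2)
  have hs' : ∀ b : B, g (s b) = b := fun b => congrFun hs b
  have : PreconnectedSpace V := isPreconnected_iff_preconnectedSpace.1 hV
  let q : V → B := fun v => ⟨g v, hVB v.2⟩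
  have hq : Continuous q := (hg.mono hVK).domRestrict.subtype_mk _
  let i : V → K := inclusion hVK
  have hi : Continuous i := continuous_inclusion _
  have key : (fun v : V => s (q v)) = i := by
    have h := hcov.isCoveringMap_restrictPreimage.eq_of_comp_eq
      (g₁ := fun v : V => (⟨s (q v), by
        change g (s (q v)) ∈ B; rw [hs']; exact (q v).2⟩ : K.domRestrict g ⁻¹' B))
      (g₂ := fun v : V => (⟨i v, hVB v.2⟩ : K.domRestrict g ⁻¹' B)) (by fun_prop) (by fun_prop)
      (funext fun v => Subtype.ext (hs' (q v))) ⟨u, hu⟩ (Subtype.ext hs₀)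
    funext v
    exact congrArg Subtype.val (congrFun h v)
  have h1 := congrFun key ⟨u, hu⟩
  have h2 := congrFun key ⟨u', hu'⟩
  have h3 : q ⟨u, hu⟩ = q ⟨u', hu'⟩ := Subtype.ext huu
  simp only [h3] at h1
  exact congrArg Subtype.val (h1.symm.trans h2)

/-- The image of a closed ball under an open map contains every ball around a value that is
disjoint from the image of the boundary. -/
theorem ball_subset_image_of_isOpen {E : Type*} [NormedAddCommGroup E] [NormedSpace ℝ E]
    {K : Set E} (hK : IsCompact K) {g : E → E} (hg : ContinuousOn g K) {y : E} {δ : ℝ}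
    (hloc : ∀ u ∈ K, g u ∈ ball y δ → g '' K ∈ 𝓝 (g u))
    (hne : ∃ u ∈ K, g u ∈ ball y δ) : ball y δ ⊆ g '' K := by
  have hc : IsClosed (g '' K) := (hK.image_of_continuousOn hg).isClosed
  have hpre : IsPreconnected (ball y δ) := (convex_ball y δ).isPreconnected
  -- Clopen argument in the connected ball: limits of interior points lie in the compact image, and
  -- `hloc` makes those in the ball interior again.
  have := hpre.subset_of_closure_inter_subset (u := interior (g '' K)) isOpen_interior ?_ ?_
  · exact this.trans interior_subset
  · obtain ⟨u, hu, hgu⟩ := hne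
    exact ⟨g u, hgu, mem_interior_iff_mem_nhds.2 (hloc u hu hgu)⟩
  · rintro z ⟨hz, hzB⟩
    obtain ⟨u, hu, rfl⟩ := hc.closure_subset_iff.2 interior_subset hz
    exact mem_interior_iff_mem_nhds.2 (hloc u hu hzB)

theorem exists_openPartialHomeomorph_of_injOn {X Y : Type*} [TopologicalSpace X]
    [TopologicalSpace Y] [Nonempty X] {S : Set X} (hS : IsOpen S) {g : X → Y}
    (hg : ContinuousOn g S) (hinj : InjOn g S) (hopen : ∀ x ∈ S, 𝓝 (g x) ≤ map g (𝓝 x)) :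
    ∃ e : OpenPartialHomeomorph X Y, e.source = S ∧ (e : X → Y) = g := by
  let e₀ : PartialEquiv X Y := hinj.toPartialEquiv g S
  refine ⟨OpenPartialHomeomorph.ofContinuousOpenRestrict e₀ hg ?_ hS, rfl, rfl⟩
  refine IsOpenMap.of_nhds_le fun x => (hopen x x.2).trans ?_
  rw [← map_nhds_subtype_coe_eq_nhds x.2 (hS.mem_nhds x.2), Filter.map_map]
  rfl

/-- On a small ball the slice at `p.2` is injective, so it maps the sphere away from `f p`. By the
tube lemma the same `δ` works for all nearby parameters. For these, no preimage of the `δ`-ball lies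
on the sphere, as the covering and clopen arguments require. The bound `R` lets the ball be taken
arbitrarily small, as is needed to prove openness. -/
theorem exists_closedBall_of_isLocalHomeomorph {E C : Type*} [NormedAddCommGroup E]
    [NormedSpace ℝ E] [FiniteDimensional ℝ E] [TopologicalSpace C] {O : Set (E × C)}
    (hO : IsOpen O) {f : E × C → E} (hf : ContinuousOn f O)
    (hloc : ∀ p ∈ O, ∃ e : OpenPartialHomeomorph E E,
      p.1 ∈ e.source ∧ EqOn (fun u => f (u, p.2)) e e.source)
    {p : E × C} (hp : p ∈ O) {R : ℝ} (hR : 0 < R) :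
    ∃ r > 0, r < R ∧ ∃ δ > 0, ∃ N ∈ 𝓝 p.2, closedBall p.1 r ×ˢ N ⊆ O ∧ ∀ c ∈ N,
      ball (f p) δ ⊆ (fun u => f (u, c)) '' closedBall p.1 r ∧
      ∀ V ⊆ closedBall p.1 r, IsPreconnected V → (∀ u ∈ V, f (u, c) ∈ ball (f p) δ) →
        InjOn (fun u => f (u, c)) V := by
  have : ProperSpace E := FiniteDimensional.proper ℝ E
  obtain ⟨e, hpe, he⟩ := hloc p hp
  have hO1 : {u | (u, p.2) ∈ O} ∈ 𝓝 p.1 :=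
    (hO.preimage (Continuous.prodMk_left p.2)).mem_nhds hp
  obtain ⟨r₀, hr₀, hr₀O⟩ := nhds_basis_closedBall.mem_iff.1
    (inter_mem hO1 (e.open_source.mem_nhds hpe))
  set r := min r₀ (R / 2)
  have hr : 0 < r := lt_min hr₀ (half_pos hR)
  have hrO : closedBall p.1 r ⊆ {u | (u, p.2) ∈ O} ∩ e.source :=
    (closedBall_subset_closedBall (min_le_left _ _)).trans hr₀O
  have hKc : IsCompact (closedBall p.1 r) := isCompact_closedBall _ _
  have hSc : IsCompact (sphere p.1 r) := isCompact_sphere _ _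
  have hfS : IsClosed ((fun u => f (u, p.2)) '' sphere p.1 r) := by
    refine (hSc.image_of_continuousOn ?_).isClosed
    exact hf.comp (Continuous.prodMk_left p.2).continuousOn
      fun u hu => (hrO (sphere_subset_closedBall hu)).1
  have hfp : f p ∉ (fun u => f (u, p.2)) '' sphere p.1 r := by
    rintro ⟨u, hu, hup⟩
    have hue := (hrO (sphere_subset_closedBall hu)).2
    have : u = p.1 := e.injOn hue hpe (by rw [← he hue, ← he hpe]; exact hup)
    simp [this, hr.ne] at hu
  obtain ⟨δ, hδ, hδS⟩ := nhds_basis_closedBall.mem_iff.1 (hfS.isOpen_compl.mem_nhds hfp)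
  have hQ : IsOpen (O ∩ f ⁻¹' (closedBall (f p) δ)ᶜ) :=
    hf.isOpen_inter_preimage hO isClosed_closedBall.isOpen_compl
  obtain ⟨u₁, N₁, -, hN₁, hu₁, hpN₁, hN₁O⟩ := generalized_tube_lemma hKc isCompact_singleton hO
    (t := {p.2}) (by rintro ⟨u, c⟩ ⟨hu, rfl⟩; exact (hrO hu).1)
  obtain ⟨u₂, N₂, -, hN₂, hu₂, hpN₂, hN₂Q⟩ := generalized_tube_lemma hSc isCompact_singleton hQ
    (t := {p.2}) (by
      rintro ⟨u, c⟩ ⟨hu, rfl⟩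
      exact ⟨(hrO (sphere_subset_closedBall hu)).1, fun h => hδS h ⟨u, hu, rfl⟩⟩)
  have hcont : ContinuousAt (fun c => f (p.1, c)) p.2 :=
    (hf.continuousAt (hO.mem_nhds hp)).comp (Continuous.prodMk_right p.1).continuousAt
  have hN₃ : {c | f (p.1, c) ∈ ball (f p) δ} ∈ 𝓝 p.2 :=
    hcont.preimage_mem_nhds (ball_mem_nhds _ hδ)
  refine ⟨r, hr, (min_le_right _ _).trans_lt (half_lt_self hR), δ, hδ,
    N₁ ∩ N₂ ∩ {c | f (p.1, c) ∈ ball (f p) δ},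
    inter_mem (inter_mem (hN₁.mem_nhds (hpN₁ rfl)) (hN₂.mem_nhds (hpN₂ rfl))) hN₃, ?_, ?_⟩
  · exact fun q hq => hN₁O ⟨hu₁ hq.1, hq.2.1.1⟩
  rintro c ⟨⟨hc₁, hc₂⟩, hc₃⟩
  have hOc : ∀ u ∈ closedBall p.1 r, (u, c) ∈ O := fun u hu => hN₁O ⟨hu₁ hu, hc₁⟩
  have hgc : ContinuousOn (fun u => f (u, c)) (closedBall p.1 r) :=
    hf.comp (Continuous.prodMk_left c).continuousOn hOc
  have hKn : ∀ u ∈ closedBall p.1 r, f (u, c) ∈ ball (f p) δ → closedBall p.1 r ∈ 𝓝 u := by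
    intro u hu huf
    rcases (mem_closedBall.1 hu).lt_or_eq with h | h
    · exact mem_of_superset (isOpen_ball.mem_nhds h) ball_subset_closedBall
    · exact absurd (ball_subset_closedBall huf) (hN₂Q ⟨hu₂ (mem_sphere.2 h), hc₂⟩).2
  constructor
  · refine ball_subset_image_of_isOpen hKc hgc (fun u hu huf => ?_)
      ⟨p.1, mem_closedBall_self hr.le, hc₃⟩
    obtain ⟨e', hue, he'⟩ := hloc (u, c) (hOc u hu)
    have h1 : (fun u => f (u, c)) =ᶠ[𝓝 u] e' :=
      Filter.eventuallyEq_of_mem (e'.open_source.mem_nhds hue) he'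
    have h2 := image_mem_map (m := fun u => f (u, c)) (hKn u hu huf)
    rwa [Filter.map_congr h1, e'.map_nhds_eq hue, ← he' hue] at h2
  · intro V hVK hV hVB
    exact injOn_of_isLocalHomeomorphOn hKc hgc
      (fun u hu huf => ⟨hKn u hu huf, hloc (u, c) (hOc u hu)⟩) hV hVK hVB

/-- A continuous family of local homeomorphisms is, together with the parameter, a local
homeomorphism. -/
theorem exists_openPartialHomeomorph_prodMk_snd {E C : Type*} [NormedAddCommGroup E]
    [NormedSpace ℝ E] [FiniteDimensional ℝ E] [TopologicalSpace C] {O : Set (E × C)}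
    (hO : IsOpen O) {f : E × C → E} (hf : ContinuousOn f O)
    (hloc : ∀ p ∈ O, ∃ e : OpenPartialHomeomorph E E,
      p.1 ∈ e.source ∧ EqOn (fun u => f (u, p.2)) e e.source)
    {p : E × C} (hp : p ∈ O) :
    ∃ Γ : OpenPartialHomeomorph (E × C) (E × C), p ∈ Γ.source ∧ Γ.source ⊆ O ∧
      ∀ q, Γ q = (f q, q.2) := by
  obtain ⟨r, hr, -, δ, hδ, N, hN, hNO, hNinj⟩ :=
    exists_closedBall_of_isLocalHomeomorph hO hf hloc hp one_pos
  obtain ⟨ρ, hρ, N', hN', hpN', hN'N, hρr, hρN⟩ : ∃ ρ > 0, ∃ N', IsOpen N' ∧ p.2 ∈ N' ∧ N' ⊆ N ∧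
      ball p.1 ρ ⊆ closedBall p.1 r ∧ ball p.1 ρ ×ˢ N' ⊆ f ⁻¹' ball (f p) δ := by
    have hfp : f ⁻¹' ball (f p) δ ∈ 𝓝 (p.1, p.2) :=
      (hf.continuousAt (hO.mem_nhds hp)).preimage_mem_nhds (ball_mem_nhds _ hδ)
    obtain ⟨A, hA, B, hB, hAB⟩ := mem_nhds_prod_iff.1 hfp
    obtain ⟨ρ, hρ, hρA⟩ := Metric.mem_nhds_iff.1 hA
    obtain ⟨N', hN', hN'o, hpN'⟩ := mem_nhds_iff.1 (inter_mem hN hB)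
    refine ⟨min ρ r, lt_min hρ hr, N', hN'o, hpN', fun c hc => (hN' hc).1, ?_, ?_⟩
    · exact (ball_subset_ball (min_le_right _ _)).trans ball_subset_closedBall
    · rintro ⟨u, c⟩ ⟨hu, hc⟩
      exact hAB ⟨hρA (ball_subset_ball (min_le_left _ _) hu), (hN' hc).2⟩
  have hSO : ball p.1 ρ ×ˢ N' ⊆ O := fun q hq => hNO ⟨hρr hq.1, hN'N hq.2⟩
  have : Nonempty (E × C) := ⟨p⟩
  have hinj : InjOn (fun q : E × C => (f q, q.2)) (ball p.1 ρ ×ˢ N') := by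
    rintro ⟨u, c⟩ ⟨hu, hc⟩ ⟨u', c'⟩ ⟨hu', -⟩ h
    simp only [Prod.mk.injEq] at h
    obtain ⟨h, rfl⟩ := h
    refine congrArg (·, c) ((hNinj c (hN'N hc)).2 _ hρr (convex_ball _ _).isPreconnected
      (fun v hv => hρN ⟨hv, hc⟩) hu hu' h)
  -- Each slice near `c` maps a ball of radius less than `R` onto a set containing one fixed
  -- `δ'`-ball. This uniformity in the parameter makes the joint map open.
  have hopen : ∀ q ∈ ball p.1 ρ ×ˢ N', 𝓝 (f q, q.2) ≤ map (fun q => (f q, q.2)) (𝓝 q) := by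
    rintro ⟨u, c⟩ hq T hT
    obtain ⟨A, hA, B, hB, hAB⟩ := mem_nhds_prod_iff.1 (mem_map.1 hT)
    obtain ⟨R, hR, hRA⟩ := Metric.mem_nhds_iff.1 hA
    obtain ⟨r', hr', hr'R, δ', hδ', N'', hN'', -, h⟩ :=
      exists_closedBall_of_isLocalHomeomorph hO hf hloc (hSO hq) hR
    refine mem_nhds_prod_iff.2 ⟨_, ball_mem_nhds _ hδ', _, inter_mem hN'' hB, ?_⟩
    rintro ⟨v, c'⟩ ⟨hv, hc'⟩
    obtain ⟨w, hw, rfl⟩ := (h c' hc'.1).1 hv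
    exact hAB (show (w, c') ∈ A ×ˢ B from ⟨hRA (closedBall_subset_ball hr'R hw), hc'.2⟩)
  obtain ⟨Γ, hΓs, hΓ⟩ := exists_openPartialHomeomorph_of_injOn (isOpen_ball.prod hN')
    (g := fun q : E × C => (f q, q.2)) ((hf.mono hSO).prodMk continuousOn_snd) hinj hopen
  exact ⟨Γ, by rw [hΓs]; exact ⟨mem_ball_self hρ, hpN'⟩, by rwa [hΓs], fun q => by rw [hΓ]⟩

/-- Two maps that are continuous near `x` and `y` and inverse to each other near these points
restrict to a homeomorphism between neighbourhoods of `x` and `y`. -/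
theorem exists_openPartialHomeomorph_of_eventually_inverse {X Y : Type*} [TopologicalSpace X]
    [TopologicalSpace Y] {f : X → Y} {g : Y → X} {x : X}
    (hf : ∀ᶠ z in 𝓝 x, ContinuousAt f z) (hg : ∀ᶠ z in 𝓝 (f x), ContinuousAt g z)
    (hgf : ∀ᶠ z in 𝓝 x, g (f z) = z) (hfg : ∀ᶠ z in 𝓝 (f x), f (g z) = z) :
    ∃ e : OpenPartialHomeomorph X Y, x ∈ e.source ∧ (∀ z, e z = f z) ∧ ∀ z, e.symm z = g z := by
  obtain ⟨O, hO, hOo, hxO⟩ := mem_nhds_iff.1 (hf.and hgf)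
  obtain ⟨T, hT, hTo, hxT⟩ := mem_nhds_iff.1 (hg.and hfg)
  have hfO : ContinuousOn f O := fun z hz => (hO hz).1.continuousWithinAt
  have hgT : ContinuousOn g T := fun z hz => (hT hz).1.continuousWithinAt
  refine ⟨{ toFun := f
            invFun := g
            source := O ∩ f ⁻¹' T
            target := T ∩ g ⁻¹' O
            map_source' := fun z hz => ⟨hz.2, by
              rw [mem_preimage, (hO hz.1).2]; exact hz.1⟩
            map_target' := fun z hz => ⟨hz.2, by
              rw [mem_preimage, (hT hz.1).2]; exact hz.1⟩
            left_inv' := fun z hz => (hO hz.1).2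
            right_inv' := fun z hz => (hT hz.1).2
            open_source := hfO.isOpen_inter_preimage hOo hTo
            open_target := hgT.isOpen_inter_preimage hTo hOo
            continuousOn_toFun := hfO.mono inter_subset_left
            continuousOn_invFun := hgT.mono inter_subset_left },
    ⟨hxO, hxT⟩, fun _ => rfl, fun _ => rfl⟩

end LocalHomeomorph

/-! ### Manifold structure defined by immersed charts -/

section ImmersedCharts

open Filter Topology Set

theorem mem_contDiffGroupoid_of_contDiffOn {m : ℕ} {s : WithTop ℕ∞}
    {e : OpenPartialHomeomorph (EuclideanSpace ℝ (Fin m)) (EuclideanSpace ℝ (Fin m))}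
    (h : ContDiffOn ℝ s e e.source) (h' : ContDiffOn ℝ s e.symm e.target) :
    e ∈ contDiffGroupoid s (𝓡 m) := by
  rw [contDiffGroupoid, mem_groupoid_of_pregroupoid]
  simpa [contDiffPregroupoid, Function.comp_def] using ⟨h, h'⟩

theorem mem_maximalAtlas_of_contMDiffAt {m : ℕ} {s : WithTop ℕ∞} {N : Type*} [TopologicalSpace N]
    [ChartedSpace (EuclideanSpace ℝ (Fin m)) N] [IsManifold (𝓡 m) s N]
    {e : OpenPartialHomeomorph N (EuclideanSpace ℝ (Fin m))}
    (h : ∀ p ∈ e.source, ContMDiffAt (𝓡 m) (𝓡 m) s e p)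
    (h' : ∀ u ∈ e.target, ContMDiffAt (𝓡 m) (𝓡 m) s e.symm u) :
    e ∈ IsManifold.maximalAtlas (𝓡 m) s N := by
  have key : ∀ e' ∈ atlas (EuclideanSpace ℝ (Fin m)) N,
      ContDiffOn ℝ s (e.symm ≫ₕ e') (e.symm ≫ₕ e').source ∧
      ContDiffOn ℝ s (e'.symm ≫ₕ e) (e'.symm ≫ₕ e).source := by
    intro e' he'
    have he'm : e' ∈ IsManifold.maximalAtlas (𝓡 m) s N :=
      IsManifold.subset_maximalAtlas he'
    refine ⟨fun u hu => ?_, fun u hu => ?_⟩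
    · have hu' : u ∈ e.target ∧ e.symm u ∈ e'.source := by simpa using hu
      have := (contMDiffAt_of_mem_maximalAtlas he'm hu'.2).comp u (h' u hu'.1)
      exact (contMDiffAt_iff_contDiffAt.1 this).contDiffWithinAt
    · have hu' : u ∈ e'.target ∧ e'.symm u ∈ e.source := by simpa using hu
      have := (h _ hu'.2).comp u (contMDiffAt_symm_of_mem_maximalAtlas he'm hu'.1)
      exact (contMDiffAt_iff_contDiffAt.1 this).contDiffWithinAt
  refine fun e' he' => ⟨mem_contDiffGroupoid_of_contDiffOn (key e' he').1 ?_,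
    mem_contDiffGroupoid_of_contDiffOn (key e' he').2 ?_⟩
  · exact (key e' he').2
  · exact (key e' he').1

variable {n m : ℕ} {M : Type*} [TopologicalSpace M]
  {W : Type*} [TopologicalSpace W]

/-- The inverse of the chart `e` of `W` is, composed with `incl : W → M`, a `C^s` immersion. -/
def IsImmersedChart (n : ℕ) [ChartedSpace (EuclideanSpace ℝ (Fin n)) M] (s : WithTop ℕ∞)
    (incl : W → M)
    (e : OpenPartialHomeomorph W (EuclideanSpace ℝ (Fin m))) : Prop :=
  ∀ u ∈ e.target, ContMDiffAt (𝓡 m) (𝓡 n) s (fun v => incl (e.symm v)) u ∧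
    Function.Injective (mfderiv (𝓡 m) (𝓡 n) (fun v => incl (e.symm v)) u)

/-- The transition map is continuous, and composing it with the immersion `incl ∘ e'.symm` gives the
`C^s` map `incl ∘ e.symm`. Hence any two immersed charts are compatible. -/
theorem IsImmersedChart.contDiffOn [ChartedSpace (EuclideanSpace ℝ (Fin n)) M]
    {s : WithTop ℕ∞} [IsManifold (𝓡 n) s M] (hs : s ≠ 0)
    {incl : W → M} {e e' : OpenPartialHomeomorph W (EuclideanSpace ℝ (Fin m))}
    (he : IsImmersedChart n s incl e) (he' : IsImmersedChart n s incl e') :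
    ContDiffOn ℝ s (e.symm ≫ₕ e') (e.symm ≫ₕ e').source := by
  intro u hu
  have hu' : u ∈ e.target ∧ e.symm u ∈ e'.source := by simpa using hu
  have ht : (e.symm ≫ₕ e') u ∈ e'.target := e'.map_source hu'.2
  refine ((contMDiffAt_iff_contDiffAt.1 ?_).contDiffWithinAt)
  refine ContMDiffAt.of_comp_immersion (n := n) (f := fun v => incl (e'.symm v)) hs ?_
    (he' _ ht).2 ((e.symm ≫ₕ e').continuousAt hu) ?_
  · filter_upwards [e'.open_target.mem_nhds ht] with v hv using (he' v hv).1
  · refine (he u hu'.1).1.congr_of_eventuallyEq ?_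
    filter_upwards [(e.symm ≫ₕ e').open_source.mem_nhds hu] with v hv
    have hv' : v ∈ e.target ∧ e.symm v ∈ e'.source := by simpa using hv
    simp [e'.left_inv hv'.2]

theorem IsImmersedChart.mem_contDiffGroupoid [ChartedSpace (EuclideanSpace ℝ (Fin n)) M]
    {s : WithTop ℕ∞} [IsManifold (𝓡 n) s M] (hs : s ≠ 0)
    {incl : W → M} {e e' : OpenPartialHomeomorph W (EuclideanSpace ℝ (Fin m))}
    (he : IsImmersedChart n s incl e) (he' : IsImmersedChart n s incl e') :
    e.symm ≫ₕ e' ∈ contDiffGroupoid s (𝓡 m) :=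
  mem_contDiffGroupoid_of_contDiffOn (he.contDiffOn hs he') (he'.contDiffOn hs he)

end ImmersedCharts

/-- A Hausdorff, second countable space with an injective map to `M` and local charts whose
inverses are immersions into `M` is an immersed submanifold. -/
noncomputable def ImmersedSubmanifold.ofCharts {r : ℕ∞} (hr : 1 ≤ r) {m n : ℕ} {M : Type u}
    [TopologicalSpace M] [ChartedSpace (EuclideanSpace ℝ (Fin n)) M] [IsManifold (𝓡 n) r M]
    (W : Type u) [TopologicalSpace W] [T2Space W] [SecondCountableTopology W] (incl : W → M)
    (hincl : Function.Injective incl)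
    (h : ∀ w, ∃ e : OpenPartialHomeomorph W (EuclideanSpace ℝ (Fin m)),
      w ∈ e.source ∧ IsImmersedChart n r incl e) : ImmersedSubmanifold r m n M :=
  have hr0 : (r : WithTop ℕ∞) ≠ 0 := by
    simpa using (zero_lt_one.trans_le hr).ne'
  letI cs : ChartedSpace (EuclideanSpace ℝ (Fin m)) W :=
    { atlas := {e | IsImmersedChart n r incl e}
      chartAt := fun w => (h w).choose
      mem_chart_source := fun w => (h w).choose_spec.1
      chart_mem_atlas := fun w => (h w).choose_spec.2 }
  haveI im : IsManifold (𝓡 m) r W :=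
    { compatible := fun he he' => IsImmersedChart.mem_contDiffGroupoid hr0 he he' }
  have key : ∀ w, ∃ e : OpenPartialHomeomorph W (EuclideanSpace ℝ (Fin m)), w ∈ e.source ∧
      IsImmersedChart n r incl e ∧ ContMDiffAt (𝓡 m) (𝓡 m) r e w ∧
      ContMDiffAt (𝓡 m) (𝓡 m) r e.symm (e w) := fun w => by
    have hm : chartAt (EuclideanSpace ℝ (Fin m)) w ∈ IsManifold.maximalAtlas (𝓡 m) r W :=
      IsManifold.chart_mem_maximalAtlas w
    exact ⟨chartAt _ w, mem_chart_source _ w, (h w).choose_spec.2,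
      contMDiffAt_of_mem_maximalAtlas hm (mem_chart_source _ w),
      contMDiffAt_symm_of_mem_maximalAtlas hm (mem_chart_target _ w)⟩
  have hev : ∀ (w : W) (e : OpenPartialHomeomorph W (EuclideanSpace ℝ (Fin m))), w ∈ e.source →
      incl =ᶠ[nhds w] (fun v => incl (e.symm v)) ∘ e := fun w e hw => by
    filter_upwards [e.open_source.mem_nhds hw] with w' hw'
    simp [e.left_inv hw']
  { Pt := W
    incl := incl
    injective_incl := hincl
    contMDiff_incl := fun w => by
      obtain ⟨e, hw, he, hes, -⟩ := key w
      exact ((he _ (e.map_source hw)).1.comp w hes).congr_of_eventuallyEq (hev w e hw)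
    injective_mfderiv := fun w => by
      obtain ⟨e, hw, he, hes, hes'⟩ := key w
      have h1 := (he _ (e.map_source hw)).1.mdifferentiableAt hr0
      have h2 := hes.mdifferentiableAt hr0
      rw [(hev w e hw).mfderiv_eq, mfderiv_comp w h1 h2]
      refine (he _ (e.map_source hw)).2.comp
        (injective_mfderiv_of_eventually_leftInverse h2 (hes'.mdifferentiableAt hr0) ?_)
      filter_upwards [e.open_source.mem_nhds hw] with w' hw' using e.left_inv hw' }

/-! ### Plaques and the topology of leaves -/

section FoliatedChart

open Filter Topology Set

variable {r : ℕ∞} {k n : ℕ} {M : Type u} [TopologicalSpace M]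
  [ChartedSpace (EuclideanSpace ℝ (Fin n)) M] {ι : Type u}
  {leaf : ι → ImmersedSubmanifold r k n M}
  {ψ : OpenPartialHomeomorph M (EuclideanSpace ℝ (Fin k) × EuclideanSpace ℝ (Fin (n - k)))}
  {U₁ : Set (EuclideanSpace ℝ (Fin k))} {U₂ : Set (EuclideanSpace ℝ (Fin (n - k)))}

theorem ImmersedSubmanifold.continuous_incl (L : ImmersedSubmanifold r k n M) :
    Continuous L.incl := L.contMDiff_incl.continuous

theorem ImmersedSubmanifold.locallyConnectedSpace (L : ImmersedSubmanifold r k n M) :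
    LocallyConnectedSpace L.Pt :=
  ChartedSpace.locallyConnectedSpace (EuclideanSpace ℝ (Fin k)) L.Pt

theorem ImmersedSubmanifold.isOpen_connectedComponentIn (L : ImmersedSubmanifold r k n M)
    {U : Set M} (hU : IsOpen U) (p : L.Pt) : IsOpen (connectedComponentIn (L.incl ⁻¹' U) p) := by
  have := L.locallyConnectedSpace
  exact (hU.preimage L.continuous_incl).connectedComponentIn

namespace IsFoliatedChart

variable (h : IsFoliatedChart leaf ψ U₁ U₂) {a : ι} {p q : (leaf a).Pt}

include h

theorem image_plaque (hp : (leaf a).incl p ∈ ψ.source) :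
    (fun q => ψ ((leaf a).incl q)) '' connectedComponentIn ((leaf a).incl ⁻¹' ψ.source) p
      = U₁ ×ˢ {(ψ ((leaf a).incl p)).2} := by
  obtain ⟨⟨c, hc⟩, -⟩ := h.plaque a p hp
  have : ψ ((leaf a).incl p) ∈ U₁ ×ˢ ({c} : Set (EuclideanSpace ℝ (Fin (n - k)))) :=
    hc ▸ mem_image_of_mem _ (mem_connectedComponentIn (F := (leaf a).incl ⁻¹' ψ.source) hp)
  rw [hc, this.2]

theorem snd_eq_of_mem_plaque (hp : (leaf a).incl p ∈ ψ.source)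
    (hq : q ∈ connectedComponentIn ((leaf a).incl ⁻¹' ψ.source) p) :
    (ψ ((leaf a).incl q)).2 = (ψ ((leaf a).incl p)).2 := by
  have : ψ ((leaf a).incl q) ∈ U₁ ×ˢ ({(ψ ((leaf a).incl p)).2} : Set _) :=
    h.image_plaque hp ▸ mem_image_of_mem _ hq
  exact this.2

/-- A leaf meets the domain of a foliated chart in countably many plaques. -/
theorem countable_snd (a : ι) :
    ((fun p => (ψ ((leaf a).incl p)).2) '' ((leaf a).incl ⁻¹' ψ.source)).Countable := by
  -- Plaques are open in the separable leaf, so each of them contains a point of a countable dense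
  -- set.
  obtain ⟨D, hDc, hD⟩ := TopologicalSpace.exists_countable_dense (leaf a).Pt
  refine (hDc.image fun p => (ψ ((leaf a).incl p)).2).mono ?_
  rintro _ ⟨p, hp, rfl⟩
  obtain ⟨d, hdp, hd⟩ := hD.inter_open_nonempty _ ((leaf a).isOpen_connectedComponentIn ψ.open_source p)
    ⟨p, mem_connectedComponentIn hp⟩
  exact ⟨d, hd, h.snd_eq_of_mem_plaque hp hdp⟩

/-- The transverse coordinate is constant along connected sets contained in a leaf. -/
theorem snd_eq_of_isPreconnected {Y : Type*} [TopologicalSpace Y] {Q : Set Y}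
    (hQ : IsPreconnected Q) {f : Y → M} (hf : ContinuousOn f Q) (hfs : MapsTo f Q ψ.source)
    (hfa : ∀ y ∈ Q, f y ∈ range (leaf a).incl) {y y' : Y} (hy : y ∈ Q) (hy' : y' ∈ Q) :
    (ψ (f y)).2 = (ψ (f y')).2 := by
  have hc : ContinuousOn (fun y => (ψ (f y)).2) Q :=
    continuous_snd.comp_continuousOn (ψ.continuousOn.comp hf hfs)
  -- A connected subset of a countable set in Euclidean space has at most one point.
  refine (h.countable_snd a).isTotallyDisconnected _ ?_ (hQ.image _ hc) ⟨y, hy, rfl⟩ ⟨y', hy', rfl⟩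
  rintro _ ⟨z, hz, rfl⟩
  obtain ⟨p, hp⟩ := hfa z hz
  exact ⟨p, by rw [mem_preimage, hp]; exact hfs hz, congrArg (fun w => (ψ w).2) hp⟩

theorem exists_mem_plaque_of_snd_eq (hp : (leaf a).incl p ∈ ψ.source) {y : M}
    (hy : y ∈ ψ.source) (hyp : (ψ y).2 = (ψ ((leaf a).incl p)).2) :
    ∃ q ∈ connectedComponentIn ((leaf a).incl ⁻¹' ψ.source) p, (leaf a).incl q = y := by
  have h1 : ψ y ∈ U₁ ×ˢ ({(ψ ((leaf a).incl p)).2} : Set (EuclideanSpace ℝ (Fin (n - k)))) := by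
    refine ⟨?_, hyp⟩
    have := ψ.map_source hy
    rw [h.target_eq] at this
    exact this.1
  rw [← h.image_plaque hp] at h1
  obtain ⟨q, hq, hqy⟩ := h1
  exact ⟨q, hq, ψ.injOn (connectedComponentIn_subset ((leaf a).incl ⁻¹' ψ.source) p hq) hy hqy⟩

end IsFoliatedChart

/-- A map to a leaf that is continuous as a map to the manifold is continuous for the topology of
the leaf. -/
theorem Foliation.continuous_of_continuous_incl (F : Foliation r k n M) {a : F.ι} {Y : Type*}
    [TopologicalSpace Y] [LocallyConnectedSpace Y] {g : Y → (F.leaf a).Pt}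
    (hg : Continuous fun y => (F.leaf a).incl (g y)) : Continuous g := by
  refine continuous_iff_continuousAt.2 fun y => ?_
  obtain ⟨ψ, U₁, U₂, hyψ, h⟩ := F.exists_chart ((F.leaf a).incl (g y))
  -- On the connected neighbourhood `Q` the transverse coordinate is constant, so `g` stays in one
  -- plaque, where the first component of `ψ` is a chart of the leaf.
  obtain ⟨Q, hQs, hQo, hyQ, hQ⟩ := locallyConnectedSpace_iff_subsets_isOpen_isConnected.1
    ‹_› y _ ((ψ.open_source.preimage hg).mem_nhds hyψ)
  obtain ⟨-, e, -, hes, he⟩ := h.plaque a (g y) hyψ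
  have hge : ∀ z ∈ Q, g z ∈ e.source := by
    intro z hz
    obtain ⟨q, hq, hqz⟩ := h.exists_mem_plaque_of_snd_eq hyψ (hQs hz)
      (h.snd_eq_of_isPreconnected hQ.isPreconnected hg.continuousOn hQs
        (fun w _ => mem_range_self (g w)) hz hyQ)
    rw [hes, ← (F.leaf a).injective_incl hqz]
    exact hq
  have hgz : ∀ z ∈ Q, g z = e.symm (ψ ((F.leaf a).incl (g z))).1 := fun z hz => by
    rw [← he _ (hge z hz), e.left_inv (hge z hz)]
  have hc : ContinuousAt (fun z => e.symm (ψ ((F.leaf a).incl (g z))).1) y := by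
    refine ContinuousAt.comp (g := e.symm) ?_ ?_
    · rw [← he _ (hge y hyQ)]
      exact e.continuousAt_symm (e.map_source (hge y hyQ))
    · have hψ : ContinuousAt (fun w => (ψ w).1) ((F.leaf a).incl (g y)) :=
        continuous_fst.continuousAt.comp (ψ.continuousAt hyψ)
      exact hψ.comp (f := fun z => (F.leaf a).incl (g z)) hg.continuousAt
  exact hc.congr (eventually_of_mem (hQo.mem_nhds hyQ) fun z hz => (hgz z hz).symm)

namespace Foliation

variable (F : Foliation r k n M)

theorem mem_leafThrough (x : M) : x ∈ F.leafThrough x := ⟨_, F.incl_leafPoint x⟩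

theorem leafThrough_incl (a : F.ι) (p : (F.leaf a).Pt) :
    F.leafThrough ((F.leaf a).incl p) = range (F.leaf a).incl := by
  rw [leafThrough, F.leafIndex_incl]

theorem leafThrough_eq_of_mem {x y : M} (h : y ∈ F.leafThrough x) :
    F.leafThrough y = F.leafThrough x := by
  obtain ⟨p, rfl⟩ := h
  exact F.leafThrough_incl _ p

end Foliation

end FoliatedChart

/-! ### Differential of the flow and its action on leaves -/

section TransverseFlow

open Filter Topology Set

variable {r : ℕ∞} {k n : ℕ} {M : Type u} [TopologicalSpace M]
  [ChartedSpace (EuclideanSpace ℝ (Fin n)) M]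

/-- The smooth flow `φ` generated by `X` preserves the foliation `F` and `X` is nowhere tangent
to `F`. -/
structure Foliation.IsTransverseFlow (F : Foliation r k n M) (φ : Flow ℝ M)
    (X : ∀ x : M, TangentSpace (𝓡 n) x) : Prop where
  contMDiff : ContMDiff (𝓘(ℝ, ℝ).prod (𝓡 n)) (𝓡 n) ∞ (fun p : ℝ × M => φ p.1 p.2)
  isMIntegralCurve : ∀ x : M, IsMIntegralCurve (I := 𝓡 n) (fun t : ℝ => φ t x) X
  image_leafThrough : ∀ (t : ℝ) (x : M), φ t '' F.leafThrough x = F.leafThrough (φ t x)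
  notMem_tangentSpace : ∀ x : M, X x ∉ F.tangentSpace x

namespace Flow

variable {φ : Flow ℝ M}

theorem apply_neg_apply (φ : Flow ℝ M) (t : ℝ) (x : M) : φ (-t) (φ t x) = x := by
  rw [← φ.map_add, neg_add_cancel, φ.map_zero_apply]

theorem apply_apply_neg (φ : Flow ℝ M) (t : ℝ) (x : M) : φ t (φ (-t) x) = x := by
  rw [← φ.map_add, add_neg_cancel, φ.map_zero_apply]

end Flow

namespace Foliation.IsTransverseFlow

variable {F : Foliation r k n M} {φ : Flow ℝ M} {X : ∀ x : M, TangentSpace (𝓡 n) x}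
  (h : F.IsTransverseFlow φ X)

include h

theorem contMDiff_apply (t : ℝ) : ContMDiff (𝓡 n) (𝓡 n) ∞ (φ t) :=
  h.contMDiff.comp (contMDiff_const.prodMk contMDiff_id)

theorem contMDiff_orbit (x : M) : ContMDiff 𝓘(ℝ, ℝ) (𝓡 n) ∞ (fun t => φ t x) :=
  h.contMDiff.comp (contMDiff_id.prodMk contMDiff_const)

theorem mfderiv_orbit (x : M) (t s : ℝ) :
    mfderiv 𝓘(ℝ, ℝ) (𝓡 n) (fun t => φ t x) t s = s • X (φ t x) := by
  rw [(h.isMIntegralCurve x t).mfderiv]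
  rfl

/-- Both sides are the derivative at `s = 0` of `φ t (φ s x) = φ (s + t) x`. -/
theorem mfderiv_apply_vectorField (t : ℝ) (x : M) :
    mfderiv (𝓡 n) (𝓡 n) (φ t) x (X x) = X (φ t x) := by
  have h1 := (h.isMIntegralCurve x).comp_add t 0
  have h2 := h.isMIntegralCurve x 0
  have h3 : HasMFDerivAt (𝓡 n) (𝓡 n) (φ t) (φ 0 x) (mfderiv (𝓡 n) (𝓡 n) (φ t) (φ 0 x)) :=
    ((h.contMDiff_apply t).mdifferentiable (by simp) _).hasMFDerivAt
  have h4 := h3.comp 0 h2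
  have h5 : (φ t ∘ fun t => φ t x) = (fun t => φ t x) ∘ (· + t) := by
    funext s
    simp [← φ.map_add, add_comm]
  rw [h5] at h4
  have h6 := hasMFDerivAt_unique h4 h1
  have h7 : (mfderiv (𝓡 n) (𝓡 n) (φ t) (φ 0 x) ((1 : ℝ) • X (φ 0 x)) : EuclideanSpace ℝ (Fin n)) =
      (1 : ℝ) • X (φ (0 + t) x) := DFunLike.congr_fun h6 (1 : ℝ)
  rw [one_smul, one_smul] at h7
  -- The points `φ 0 x` and `φ (0 + t) x` equal `x` and `φ t x` only propositionally, so the tangent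
  -- spaces are identified by generalizing the points.
  have key : ∀ y z : M, y = x → z = φ t x →
      (mfderiv (𝓡 n) (𝓡 n) (φ t) y (X y) : EuclideanSpace ℝ (Fin n)) = X z →
      mfderiv (𝓡 n) (𝓡 n) (φ t) x (X x) = X (φ t x) := by
    rintro y z rfl rfl hyz
    exact hyz
  exact key _ _ (φ.map_zero_apply x) (by rw [zero_add]) h7

theorem injective_mfderiv_apply (t : ℝ) (x : M) :
    Function.Injective (mfderiv (𝓡 n) (𝓡 n) (φ t) x) :=
  injective_mfderiv_of_eventually_leftInverse ((h.contMDiff_apply t).mdifferentiable (by simp) _)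
    ((h.contMDiff_apply (-t)).mdifferentiable (by simp) _)
    (Eventually.of_forall fun y => φ.apply_neg_apply t y)

/-- Invariance of `X` puts the time direction and the space direction inside one injective
differential. Injectivity is then decided at `g p`, before flowing, where `X` is transverse to the
leaf. -/
theorem mfderiv_flow_comp {m : ℕ} {N : Type*} [TopologicalSpace N]
    [ChartedSpace (EuclideanSpace ℝ (Fin m)) N] {f : N → ℝ} {g : N → M} {p : N}
    (hf : MDifferentiableAt (𝓡 m) 𝓘(ℝ, ℝ) f p) (hg : MDifferentiableAt (𝓡 m) (𝓡 n) g p)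
    {v : TangentSpace (𝓡 m) p} {s : ℝ} (hs : mfderiv (𝓡 m) 𝓘(ℝ, ℝ) f p v = s) :
    mfderiv (𝓡 m) (𝓡 n) (fun q => φ (f q) (g q)) p v = mfderiv (𝓡 n) (𝓡 n) (φ (f p)) (g p)
      (s • X (g p) + mfderiv (𝓡 m) (𝓡 n) g p v) := by
  subst hs
  have h0 : MDifferentiableAt (𝓘(ℝ, ℝ).prod (𝓡 n)) (𝓡 n) (fun p : ℝ × M => φ p.1 p.2)
      (f p, g p) := h.contMDiff.mdifferentiable (by simp) _
  have h1 : mfderiv (𝓡 m) (𝓡 n) (fun q => φ (f q) (g q)) p =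
      (mfderiv (𝓘(ℝ, ℝ).prod (𝓡 n)) (𝓡 n) (fun p : ℝ × M => φ p.1 p.2) (f p, g p)).comp
        (mfderiv (𝓡 m) (𝓘(ℝ, ℝ).prod (𝓡 n)) (fun q => (f q, g q)) p) :=
    mfderiv_comp p h0 (hf.prodMk hg)
  rw [h1, mfderiv_prodMk hf hg]
  refine (mfderiv_prod_eq_add_apply h0).trans (Eq.trans ?_ (map_add _ _ _).symm)
  refine congrArg₂ _ ((h.mfderiv_orbit _ _ _).trans (Eq.trans ?_ (map_smul _ _ _).symm)) rfl
  rw [h.mfderiv_apply_vectorField]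
  rfl

theorem eq_zero_of_smul_add_eq_zero {x : M} {s : ℝ} {w : TangentSpace (𝓡 n) x}
    (hw : w ∈ F.tangentSpace x) (hs : s • X x + w = 0) : s = 0 ∧ w = 0 := by
  have h0 : s = 0 := by
    by_contra hs0
    refine h.notMem_tangentSpace x ?_
    rw [← (F.tangentSpace x).smul_mem_iff hs0, eq_neg_of_add_eq_zero_left hs]
    exact neg_mem hw
  refine ⟨h0, ?_⟩
  rwa [h0, zero_smul, zero_add] at hs

/-- The flow lifts to maps between leaves that are continuous for the topology of the leaves. -/
theorem exists_continuous_lift {a b : F.ι} {t : ℝ} {p : (F.leaf a).Pt} {q : (F.leaf b).Pt}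
    (hpq : φ t ((F.leaf a).incl p) = (F.leaf b).incl q) :
    ∃ g : (F.leaf a).Pt → (F.leaf b).Pt, Continuous g ∧
      ∀ p, (F.leaf b).incl (g p) = φ t ((F.leaf a).incl p) := by
  have h1 := h.image_leafThrough t ((F.leaf a).incl p)
  rw [hpq, F.leafThrough_incl, F.leafThrough_incl] at h1
  have h2 : ∀ p, ∃ q, (F.leaf b).incl q = φ t ((F.leaf a).incl p) := fun p =>
    (h1 ▸ mem_image_of_mem _ (mem_range_self p) : _ ∈ range (F.leaf b).incl)
  choose g hg using h2
  have := (F.leaf a).locallyConnectedSpace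
  refine ⟨g, F.continuous_of_continuous_incl ?_, hg⟩
  simp only [hg]
  exact φ.continuous continuous_const (F.leaf a).continuous_incl

end Foliation.IsTransverseFlow

end TransverseFlow

/-! ### The saturation of a leaf as a quotient -/

section Saturation

open Filter Topology Set

variable {r : ℕ∞} {k n : ℕ} {M : Type u} [TopologicalSpace M]
  [ChartedSpace (EuclideanSpace ℝ (Fin n)) M]

namespace Foliation

/-- The map `(t, p) ↦ φ t p` from `ℝ × L` to `M`, for a leaf `L` of `F`. -/
def flowMap (F : Foliation r k n M) (φ : Flow ℝ M) (a : F.ι) (z : ℝ × (F.leaf a).Pt) : M :=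
  φ z.1 ((F.leaf a).incl z.2)

/-- The saturation of a leaf under the flow, with the quotient topology of `ℝ × L`. -/
abbrev Saturation (F : Foliation r k n M) (φ : Flow ℝ M) (a : F.ι) : Type u :=
  Quotient (Setoid.ker (F.flowMap φ a))

/-- The inclusion of the saturation of a leaf in the manifold. -/
def saturationIncl (F : Foliation r k n M) (φ : Flow ℝ M) (a : F.ι) : F.Saturation φ a → M :=
  Setoid.kerLift (F.flowMap φ a)

variable {F : Foliation r k n M} {φ : Flow ℝ M} {X : ∀ x : M, TangentSpace (𝓡 n) x}

theorem continuous_flowMap (a : F.ι) : Continuous (F.flowMap φ a) :=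
  φ.continuous continuous_fst ((F.leaf a).continuous_incl.comp continuous_snd)

@[simp]
theorem saturationIncl_mk (a : F.ι) (z : ℝ × (F.leaf a).Pt) :
    F.saturationIncl φ a (Quotient.mk _ z) = φ z.1 ((F.leaf a).incl z.2) := rfl

theorem injective_saturationIncl (a : F.ι) : Function.Injective (F.saturationIncl φ a) :=
  Setoid.kerLift_injective _

theorem continuous_saturationIncl (a : F.ι) : Continuous (F.saturationIncl φ a) :=
  (continuous_flowMap a).quotient_lift _

theorem continuous_saturation_mk (a : F.ι) :
    Continuous (fun z => (Quotient.mk _ z : F.Saturation φ a)) := continuous_quotient_mk'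

/-- If `(t, p)` and `(t', p')` are identified, then `φ (t - t')` carries the leaf to itself and
lifts to a continuous `g`. The map `(s, q) ↦ (s - (t - t'), g q)` takes `(t, p)` to `(t', p')`
without changing classes, so the set of points equivalent to points of an open set is open. -/
theorem IsTransverseFlow.isOpenMap_saturation_mk (h : F.IsTransverseFlow φ X) (a : F.ι) :
    IsOpenMap (fun z => (Quotient.mk _ z : F.Saturation φ a)) := by
  intro V hV
  rw [isOpen_coinduced]
  refine isOpen_iff_mem_nhds.2 ?_
  rintro ⟨t, p⟩ ⟨⟨t', p'⟩, hV', htp⟩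
  have htp' : φ t' ((F.leaf a).incl p') = φ t ((F.leaf a).incl p) := Quotient.exact htp
  obtain ⟨g, hg, hgi⟩ := h.exists_continuous_lift (a := a) (b := a) (t := t - t') (p := p) (q := p')
    (by rw [sub_eq_neg_add, φ.map_add, ← htp', φ.apply_neg_apply])
  have hgp : g p = p' := (F.leaf a).injective_incl (by
    rw [hgi, sub_eq_neg_add, φ.map_add, ← htp', φ.apply_neg_apply])
  have hc : Continuous fun z : ℝ × (F.leaf a).Pt => (z.1 - (t - t'), g z.2) := by fun_prop
  refine mem_of_superset ((hV.preimage hc).mem_nhds (by simpa [hgp] using hV')) ?_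
  rintro ⟨s, q⟩ hsq
  refine ⟨_, hsq, Quotient.sound ?_⟩
  change φ (s - (t - t')) ((F.leaf a).incl (g q)) = φ s ((F.leaf a).incl q)
  rw [hgi, ← φ.map_add, sub_add_cancel]

theorem IsTransverseFlow.secondCountableTopology_saturation (h : F.IsTransverseFlow φ X)
    (a : F.ι) : SecondCountableTopology (F.Saturation φ a) :=
  isQuotientMap_quotient_mk'.secondCountableTopology (h.isOpenMap_saturation_mk a)

theorem connectedSpace_saturation (a : F.ι) : ConnectedSpace (F.Saturation φ a) := by
  have := F.connectedSpace_leaf a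
  infer_instance

variable [IsManifold (𝓡 n) ∞ M]

/-- In a chart of `ℝ × L` the flow map is an immersion by transversality, hence locally injective.
The open quotient map is therefore a local homeomorphism, through which the chart descends. -/
theorem IsTransverseFlow.exists_isImmersedChart (h : F.IsTransverseFlow φ X) (hr : 1 ≤ r)
    (a : F.ι) (w : F.Saturation φ a) :
    ∃ e : OpenPartialHomeomorph (F.Saturation φ a) (EuclideanSpace ℝ (Fin (k + 1))),
      w ∈ e.source ∧ IsImmersedChart n r (F.saturationIncl φ a) e := by
  have hr0 : (r : WithTop ℕ∞) ≠ 0 := by simpa using (zero_lt_one.trans_le hr).ne'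
  have : IsManifold (𝓡 n) r M := IsManifold.of_le (n := ∞) (by exact_mod_cast le_top)
  obtain ⟨⟨t₀, p₀⟩, rfl⟩ := Quotient.exists_rep w
  let e₀ := chartAt (EuclideanSpace ℝ (Fin k)) p₀
  have he₀ : e₀ ∈ IsManifold.maximalAtlas (𝓡 k) r (F.leaf a).Pt :=
    IsManifold.chart_mem_maximalAtlas p₀
  let ε : EuclideanSpace ℝ (Fin (k + 1)) ≃L[ℝ] (ℝ × EuclideanSpace ℝ (Fin k)) :=
    ContinuousLinearEquiv.ofFinrankEq (by simp [add_comm])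
  let e₁ : OpenPartialHomeomorph (ℝ × (F.leaf a).Pt) (EuclideanSpace ℝ (Fin (k + 1))) :=
    ((OpenPartialHomeomorph.refl ℝ).prod e₀) ≫ₕ ε.symm.toHomeomorph.toOpenPartialHomeomorph
  have he₁t : ∀ u, u ∈ e₁.target ↔ (ε u).2 ∈ e₀.target := by
    intro u
    simp [e₁]
  have he₁s : ∀ u, e₁.symm u = ((ε u).1, e₀.symm (ε u).2) := fun u => rfl
  set G : EuclideanSpace ℝ (Fin (k + 1)) → M := fun u => F.flowMap φ a (e₁.symm u)
  have hε1 : ContMDiff (𝓡 (k + 1)) 𝓘(ℝ, ℝ) r (fun u => (ε u).1) :=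
    (contDiff_fst.comp ε.contDiff).contMDiff
  have hε2 : ContMDiff (𝓡 (k + 1)) (𝓡 k) r (fun u => (ε u).2) :=
    (contDiff_snd.comp ε.contDiff).contMDiff
  have hs : ∀ u, (ε u).2 ∈ e₀.target →
      ContMDiffAt (𝓡 (k + 1)) (𝓡 k) r (fun u => e₀.symm (ε u).2) u := fun u hu =>
    (contMDiffAt_symm_of_mem_maximalAtlas he₀ hu).comp u (hε2 u)
  have hi : ∀ u, (ε u).2 ∈ e₀.target →
      ContMDiffAt (𝓡 (k + 1)) (𝓡 n) r (fun u => (F.leaf a).incl (e₀.symm (ε u).2)) u :=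
    fun u hu => (F.leaf a).contMDiff_incl.contMDiffAt.comp u (hs u hu)
  have hG : ∀ u ∈ e₁.target, ContMDiffAt (𝓡 (k + 1)) (𝓡 n) r G u ∧
      Function.Injective (mfderiv (𝓡 (k + 1)) (𝓡 n) G u) := by
    intro u hu
    rw [he₁t] at hu
    constructor
    · exact ((h.contMDiff.of_le (by exact_mod_cast le_top)).contMDiffAt).comp u
        ((hε1 u).prodMk (hi u hu))
    · refine (injective_iff_map_eq_zero _).2 fun v hv => ?_
      have h1 : mfderiv (𝓡 (k + 1)) 𝓘(ℝ, ℝ) (fun u => (ε u).1) u v = (ε v).1 := by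
        have := ((ContinuousLinearMap.fst ℝ ℝ (EuclideanSpace ℝ (Fin k))).comp
          (ε : EuclideanSpace ℝ (Fin (k + 1)) →L[ℝ] _)).hasMFDerivAt (x := u)
        exact DFunLike.congr_fun this.mfderiv v
      have h2 : mfderiv (𝓡 (k + 1)) (𝓡 k) (fun u => (ε u).2) u v = (ε v).2 := by
        have := ((ContinuousLinearMap.snd ℝ ℝ (EuclideanSpace ℝ (Fin k))).comp
          (ε : EuclideanSpace ℝ (Fin (k + 1)) →L[ℝ] _)).hasMFDerivAt (x := u)
        exact DFunLike.congr_fun this.mfderiv v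
      have h3 := h.mfderiv_flow_comp ((hε1 u).mdifferentiableAt hr0)
        ((hi u hu).mdifferentiableAt hr0) h1
      have h4 := (injective_iff_map_eq_zero _).1 (h.injective_mfderiv_apply _ _) _
        (h3.symm.trans hv)
      have he₀' := contMDiffAt_symm_of_mem_maximalAtlas he₀ hu
      have h5 : mfderiv (𝓡 (k + 1)) (𝓡 n) (fun u => (F.leaf a).incl (e₀.symm (ε u).2)) u =
          (mfderiv (𝓡 k) (𝓡 n) (F.leaf a).incl (e₀.symm (ε u).2)).comp
            (mfderiv (𝓡 (k + 1)) (𝓡 k) (fun u => e₀.symm (ε u).2) u) :=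
        mfderiv_comp u (((F.leaf a).contMDiff_incl.mdifferentiable hr0) _)
          ((hs u hu).mdifferentiableAt hr0)
      have h6 : mfderiv (𝓡 (k + 1)) (𝓡 k) (fun u => e₀.symm (ε u).2) u =
          (mfderiv (𝓡 k) (𝓡 k) e₀.symm (ε u).2).comp
            (mfderiv (𝓡 (k + 1)) (𝓡 k) (fun u => (ε u).2) u) :=
        mfderiv_comp u (he₀'.mdifferentiableAt hr0) ((hε2 u).mdifferentiableAt hr0)
      obtain ⟨h7, h8⟩ := h.eq_zero_of_smul_add_eq_zero
        (by rw [F.tangentSpace_incl, h5]; exact ⟨_, rfl⟩) h4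
      rw [h5] at h8
      have h9 := (injective_iff_map_eq_zero _).1 ((F.leaf a).injective_mfderiv _) _ h8
      rw [h6] at h9
      have h10 := (injective_iff_map_eq_zero _).1 (injective_mfderiv_of_eventually_leftInverse
        (he₀'.mdifferentiableAt hr0) ((contMDiffAt_of_mem_maximalAtlas he₀
          (e₀.map_target hu)).mdifferentiableAt hr0) (by
          filter_upwards [e₀.open_target.mem_nhds hu] with u' hu' using e₀.right_inv hu')) _ h9
      exact (ε.map_eq_zero_iff).1 (Prod.ext h7 (h2.symm.trans h10))
  have hz₀ : ((t₀, p₀) : ℝ × (F.leaf a).Pt) ∈ e₁.source := by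
    simp [e₁, e₀]
  have hGe : ∀ z ∈ e₁.source, G (e₁ z) = F.flowMap φ a z := fun z hz => by
    simp only [G, e₁.left_inv hz]
  -- Identified points have the same image under `flowMap`, so a left inverse of `G` separates the
  -- classes near `(t₀, p₀)`.
  obtain ⟨l, -, hl⟩ := exists_eventually_contMDiffAt_leftInverse hr0 (f := G) (p := e₁ (t₀, p₀))
    (by
      filter_upwards [e₁.open_target.mem_nhds (e₁.map_source hz₀)] with u hu using (hG u hu).1)
    (hG _ (e₁.map_source hz₀)).2
  obtain ⟨O, hO, hOo, hzO⟩ := mem_nhds_iff.1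
    (inter_mem (e₁.open_source.mem_nhds hz₀) ((e₁.continuousAt hz₀).eventually hl))
  have : Nonempty (ℝ × (F.leaf a).Pt) := ⟨(t₀, p₀)⟩
  obtain ⟨π, hπs, hπ⟩ := exists_openPartialHomeomorph_of_injOn
    (g := fun z => (Quotient.mk _ z : F.Saturation φ a)) hOo
    (continuous_saturation_mk a).continuousOn (fun z hz z' hz' hzz => by
      have h1 : F.flowMap φ a z = F.flowMap φ a z' := Quotient.exact hzz
      have h2 : l (G (e₁ z)) = e₁ z := (hO hz).2
      have h3 : l (G (e₁ z')) = e₁ z' := (hO hz').2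
      rw [hGe _ (hO hz).1] at h2
      rw [hGe _ (hO hz').1, ← h1, h2] at h3
      exact e₁.injOn (hO hz).1 (hO hz').1 h3)
    (fun z _ => (h.isOpenMap_saturation_mk a).nhds_le z)
  refine ⟨π.symm ≫ₕ e₁, ?_, fun u hu => ?_⟩
  · have hzπ : (t₀, p₀) ∈ π.source := hπs ▸ hzO
    have h1 : Quotient.mk _ (t₀, p₀) = π (t₀, p₀) := by rw [hπ]
    rw [h1]
    simp [hzπ, hz₀, π.map_source hzπ]
  · have h1 : (fun v => F.saturationIncl φ a ((π.symm ≫ₕ e₁).symm v)) = G := by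
      funext v
      simp only [OpenPartialHomeomorph.trans_symm_eq_symm_trans_symm, OpenPartialHomeomorph.symm_symm,
        OpenPartialHomeomorph.coe_trans, Function.comp_apply, hπ]
      rfl
    rw [h1]
    exact hG u (by
      rw [OpenPartialHomeomorph.trans_target] at hu
      exact hu.1)

end Foliation

end Saturation

/-! ### Tangent spaces of the saturation -/

section SaturationSubmanifold

open Filter Topology Set

variable {r : ℕ∞} {k n : ℕ} {M : Type u} [TopologicalSpace M]
  [ChartedSpace (EuclideanSpace ℝ (Fin n)) M]

/-- The differential of a map that factors continuously through an immersed submanifold takes its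
values in the tangent space of the submanifold. -/
theorem ImmersedSubmanifold.mfderiv_mem_range [IsManifold (𝓡 n) r M] (hr : 1 ≤ r)
    (W : ImmersedSubmanifold r k n M) {G H Y : Type*} [NormedAddCommGroup G] [NormedSpace ℝ G]
    [TopologicalSpace H] {J : ModelWithCorners ℝ G H} [TopologicalSpace Y] [ChartedSpace H Y]
    {f : Y → M} {g : Y → W.Pt} (hgf : ∀ y, W.incl (g y) = f y) {y : Y} (hg : ContinuousAt g y)
    (hf : ContMDiffAt J (𝓡 n) r f y) {w : W.Pt} (hw : g y = w) (v : TangentSpace J y) :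
    (show TangentSpace (𝓡 n) (W.incl w) from mfderiv J (𝓡 n) f y v) ∈
      (mfderiv (𝓡 k) (𝓡 n) W.incl w).range := by
  have hr0 : (r : WithTop ℕ∞) ≠ 0 := by simpa using (zero_lt_one.trans_le hr).ne'
  subst hw
  obtain rfl : (fun y => W.incl (g y)) = f := funext hgf
  have hgs : ContMDiffAt J (𝓡 k) r g y := ContMDiffAt.of_comp_immersion (n := n) (f := W.incl) hr0
    (Eventually.of_forall fun _ => W.contMDiff_incl _) (W.injective_mfderiv _) hg hf
  have hd : mfderiv J (𝓡 n) (fun y => W.incl (g y)) y =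
      (mfderiv (𝓡 k) (𝓡 n) W.incl (g y)).comp (mfderiv J (𝓡 k) g y) :=
    mfderiv_comp y (W.contMDiff_incl.mdifferentiable hr0 _) (hgs.mdifferentiableAt hr0)
  rw [hd]
  exact ⟨_, rfl⟩

theorem Foliation.exists_mfderiv_eq_of_mem_tangentSpace (F : Foliation r k n M) {b : F.ι}
    {q : (F.leaf b).Pt} {x : M} (hq : (F.leaf b).incl q = x) {v : TangentSpace (𝓡 n) x}
    (hv : v ∈ F.tangentSpace x) :
    ∃ ξ : TangentSpace (𝓡 k) q,
      (show TangentSpace (𝓡 n) x from mfderiv (𝓡 k) (𝓡 n) (F.leaf b).incl q ξ) = v := by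
  subst hq
  rw [F.tangentSpace_incl] at hv
  exact hv

namespace Foliation.IsTransverseFlow

variable {F : Foliation r k n M} {φ : Flow ℝ M} {X : ∀ x : M, TangentSpace (𝓡 n) x}

theorem ne_zero (h : F.IsTransverseFlow φ X) (x : M) : X x ≠ 0 := fun h0 =>
  h.notMem_tangentSpace x (h0 ▸ zero_mem _)

theorem disjoint_span (h : F.IsTransverseFlow φ X) (x : M) :
    Disjoint (F.tangentSpace x) (Submodule.span ℝ {X x}) :=
  (Submodule.disjoint_span_singleton' (h.ne_zero x)).2 (h.notMem_tangentSpace x)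

theorem finrank_tangentSpace (F : Foliation r k n M) (x : M) :
    Module.finrank ℝ (F.tangentSpace x) = k := by
  have key : ∀ (b : F.ι) (q : (F.leaf b).Pt),
      Module.finrank ℝ (F.tangentSpace ((F.leaf b).incl q)) = k := by
    intro b q
    rw [F.tangentSpace_incl]
    refine (LinearMap.finrank_range_of_inj ((F.leaf b).injective_mfderiv q)).trans ?_
    exact finrank_euclideanSpace_fin
  have := key _ (F.leafPoint x)
  rwa [F.incl_leafPoint] at this

theorem finrank_tangentSpace_sup_span (h : F.IsTransverseFlow φ X) (x : M) :
    Module.finrank ℝ (F.tangentSpace x ⊔ Submodule.span ℝ {X x} :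
      Submodule ℝ (TangentSpace (𝓡 n) x)) = k + 1 := by
  have : FiniteDimensional ℝ (TangentSpace (𝓡 n) x) :=
    inferInstanceAs (FiniteDimensional ℝ (EuclideanSpace ℝ (Fin n)))
  have h1 := Submodule.finrank_sup_add_finrank_inf_eq (F.tangentSpace x)
    (Submodule.span ℝ {X x})
  rwa [(h.disjoint_span x).eq_bot, finrank_bot, add_zero, finrank_tangentSpace,
    finrank_span_singleton (h.ne_zero x)] at h1

/-- The saturation of `a` is also parametrized by leaf `b`: the lift of `φ (-s)` brings `b` back to
`a`, and the time is increased by `s` to compensate. -/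
theorem exists_continuous_saturation (h : F.IsTransverseFlow φ X) {a b : F.ι} {s : ℝ}
    {p : (F.leaf a).Pt} {q : (F.leaf b).Pt} (hpq : φ s ((F.leaf a).incl p) = (F.leaf b).incl q)
    {Y : Type*} [TopologicalSpace Y] {τ : Y → ℝ} {g : Y → (F.leaf b).Pt} (hτ : Continuous τ)
    (hg : Continuous g) :
    ∃ H : Y → F.Saturation φ a, Continuous H ∧
      ∀ y, F.saturationIncl φ a (H y) = φ (τ y) ((F.leaf b).incl (g y)) := by
  obtain ⟨g', hg', hgi⟩ := h.exists_continuous_lift (a := b) (b := a) (t := -s) (p := q) (q := p)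
    (by rw [← hpq, φ.apply_neg_apply])
  refine ⟨fun y => Quotient.mk _ (τ y + s, g' (g y)),
    (continuous_saturation_mk a).comp (by fun_prop), fun y => ?_⟩
  rw [saturationIncl_mk, hgi, φ.map_add, φ.apply_apply_neg]

variable [T2Space M] [IsManifold (𝓡 n) ∞ M]

/-- The saturation of a leaf under the flow, as an immersed submanifold. -/
noncomputable def saturation (h : F.IsTransverseFlow φ X) (hr : 1 ≤ r) (a : F.ι) :
    ImmersedSubmanifold r (k + 1) n M :=
  have : T2Space (F.Saturation φ a) :=
    T2Space.of_injective_continuous (injective_saturationIncl a) (continuous_saturationIncl a)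
  have := h.secondCountableTopology_saturation a
  have : IsManifold (𝓡 n) r M := IsManifold.of_le (n := ∞) (by exact_mod_cast le_top)
  ImmersedSubmanifold.ofCharts hr (F.Saturation φ a) (F.saturationIncl φ a)
    (injective_saturationIncl a) (h.exists_isImmersedChart hr a)

theorem range_saturation_incl (h : F.IsTransverseFlow φ X) (hr : 1 ≤ r) (a : F.ι) :
    range (h.saturation hr a).incl = ⋃ t : ℝ, φ t '' range (F.leaf a).incl := by
  ext x
  simp only [mem_iUnion, mem_image, mem_range]
  constructor
  · rintro ⟨w, rfl⟩
    obtain ⟨⟨t, p⟩, rfl⟩ := Quotient.exists_rep w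
    exact ⟨t, _, ⟨p, rfl⟩, rfl⟩
  · rintro ⟨t, _, ⟨p, rfl⟩, rfl⟩
    exact ⟨Quotient.mk _ (t, p), rfl⟩

theorem exists_continuous_saturation_incl (h : F.IsTransverseFlow φ X) (hr : 1 ≤ r)
    {a b : F.ι} {s : ℝ} {p : (F.leaf a).Pt} {q : (F.leaf b).Pt}
    (hpq : φ s ((F.leaf a).incl p) = (F.leaf b).incl q) {Y : Type*} [TopologicalSpace Y]
    {τ : Y → ℝ} {g : Y → (F.leaf b).Pt} (hτ : Continuous τ) (hg : Continuous g) :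
    ∃ H : Y → (h.saturation hr a).Pt, Continuous H ∧
      ∀ y, (h.saturation hr a).incl (H y) = φ (τ y) ((F.leaf b).incl (g y)) :=
  h.exists_continuous_saturation hpq hτ hg

/-- The leaf of `F` and the orbit through the point both map continuously into the saturation, so
their tangent directions lie in the range. Both sides have dimension `k + 1`. -/
theorem range_mfderiv_saturation_incl (h : F.IsTransverseFlow φ X) (hr : 1 ≤ r) (a : F.ι)
    (w : (h.saturation hr a).Pt) :
    (mfderiv (𝓡 (k + 1)) (𝓡 n) (h.saturation hr a).incl w).range =
      F.tangentSpace ((h.saturation hr a).incl w) ⊔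
        Submodule.span ℝ {X ((h.saturation hr a).incl w)} := by
  have hrt : (r : WithTop ℕ∞) ≤ ∞ := by exact_mod_cast le_top
  have : IsManifold (𝓡 n) r M := IsManifold.of_le (n := ∞) hrt
  have hle : F.tangentSpace ((h.saturation hr a).incl w) ⊔
      Submodule.span ℝ {X ((h.saturation hr a).incl w)} ≤
      (mfderiv (𝓡 (k + 1)) (𝓡 n) (h.saturation hr a).incl w).range := by
    obtain ⟨⟨t, p⟩, htp⟩ := Quotient.exists_rep (s := Setoid.ker (F.flowMap φ a)) w
    have hx : φ t ((F.leaf a).incl p) = (h.saturation hr a).incl w :=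
      congrArg (h.saturation hr a).incl htp
    refine sup_le (fun v hv => ?_) ?_
    · obtain ⟨b, q, hq⟩ : ∃ b q, (F.leaf b).incl q = (h.saturation hr a).incl w :=
        ⟨_, _, F.incl_leafPoint _⟩
      obtain ⟨H, hH, hHi⟩ := h.exists_continuous_saturation_incl hr (hx.trans hq.symm)
        (τ := fun _ : (F.leaf b).Pt => 0) (g := id) continuous_const continuous_id
      simp only [φ.map_zero_apply, id] at hHi
      obtain ⟨ξ, rfl⟩ := F.exists_mfderiv_eq_of_mem_tangentSpace hq hv
      exact (h.saturation hr a).mfderiv_mem_range hr hHi hH.continuousAt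
        ((F.leaf b).contMDiff_incl q)
        ((h.saturation hr a).injective_incl ((hHi q).trans hq)) ξ
    · rw [Submodule.span_singleton_le_iff_mem]
      have h1 := (h.saturation hr a).mfderiv_mem_range hr (y := t) (w := w)
        (f := fun s => φ s ((F.leaf a).incl p))
        (g := fun s => (Quotient.mk _ (s, p) : F.Saturation φ a)) (fun _ => rfl)
        ((continuous_saturation_mk a).comp (by fun_prop)).continuousAt
        ((h.contMDiff_orbit _).of_le hrt _) htp (1 : ℝ)
      rw [h.mfderiv_orbit, one_smul] at h1
      subst htp
      exact h1
  have : FiniteDimensional ℝ (TangentSpace (𝓡 n) ((h.saturation hr a).incl w)) :=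
    inferInstanceAs (FiniteDimensional ℝ (EuclideanSpace ℝ (Fin n)))
  refine (Submodule.eq_of_le_of_finrank_eq hle ?_).symm
  rw [h.finrank_tangentSpace_sup_span]
  refine ((LinearMap.finrank_range_of_inj
    ((h.saturation hr a).injective_mfderiv w)).trans ?_).symm
  exact finrank_euclideanSpace_fin

end Foliation.IsTransverseFlow

end SaturationSubmanifold

/-! ### Continuous subbundles -/

section Subbundle

open Filter Topology Set

variable {r : ℕ∞} {k n : ℕ} {M : Type u} [TopologicalSpace M]
  [ChartedSpace (EuclideanSpace ℝ (Fin n)) M] [IsManifold (𝓡 n) ∞ M]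

/-- The differential of `f` along a continuous vector field is continuous. -/
theorem continuousAt_mfderiv_apply {m : ℕ} {f : M → EuclideanSpace ℝ (Fin m)} {x₀ : M}
    (hf : ∀ᶠ x in 𝓝 x₀, ContMDiffAt (𝓡 n) (𝓡 m) 1 f x) {V : ∀ x : M, TangentSpace (𝓡 n) x}
    (hV : ContinuousAt (fun x => (⟨x, V x⟩ : TangentBundle (𝓡 n) M)) x₀) :
    ContinuousAt (fun x => (mfderiv (𝓡 n) (𝓡 m) f x (V x) : EuclideanSpace ℝ (Fin m))) x₀ := by
  have : IsManifold (𝓡 n) 1 M := IsManifold.of_le (n := ∞) (by simp)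
  obtain ⟨O, hO, hOo, hxO⟩ := mem_nhds_iff.1 hf
  have h1 : ContMDiffOn (𝓡 n) (𝓡 m) 1 f O := fun x hx => (hO hx).contMDiffWithinAt
  have h2 := h1.continuousOn_tangentMapWithin le_rfl hOo.uniqueMDiffOn
  have h3 : IsOpen (Bundle.TotalSpace.proj ⁻¹' O : Set (TangentBundle (𝓡 n) M)) :=
    hOo.preimage (FiberBundle.continuous_proj _ _)
  have h4 : ContinuousAt (fun x => tangentMapWithin (𝓡 n) (𝓡 m) f O ⟨x, V x⟩) x₀ :=
    ContinuousAt.comp (f := fun x => (⟨x, V x⟩ : TangentBundle (𝓡 n) M))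
      (h2.continuousAt (h3.mem_nhds hxO)) hV
  have h5 : ContinuousAt (fun x => ((tangentBundleModelSpaceHomeomorph (𝓡 m))
      (tangentMapWithin (𝓡 n) (𝓡 m) f O ⟨x, V x⟩)).2) x₀ :=
    continuous_snd.continuousAt.comp
      ((tangentBundleModelSpaceHomeomorph (𝓡 m)).continuous.continuousAt.comp h4)
  refine h5.congr ?_
  filter_upwards [hOo.mem_nhds hxO] with x hx
  simp [tangentBundleModelSpaceHomeomorph_coe, tangentMapWithin, mfderivWithin_of_isOpen hOo hx]
  rfl

/-- The differential of `f` maps a continuous frame of `D` to continuous vectors, and linear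
independence is an open condition. -/
theorem IsContinuousSubbundle.eventually_mfderiv_injective
    {D : ∀ x, Submodule ℝ (TangentSpace (𝓡 n) x)}
    (hD : IsContinuousSubbundle k D) {m : ℕ} {f : M → EuclideanSpace ℝ (Fin m)} {x₀ : M}
    (hf : ∀ᶠ x in 𝓝 x₀, ContMDiffAt (𝓡 n) (𝓡 m) 1 f x)
    (h0 : ∀ v ∈ D x₀, mfderiv (𝓡 n) (𝓡 m) f x₀ v = 0 → v = 0) :
    ∀ᶠ x in 𝓝 x₀, ∀ v ∈ D x, mfderiv (𝓡 n) (𝓡 m) f x v = 0 → v = 0 := by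
  obtain ⟨U, hU, hxU, s, hs, hsD⟩ := hD x₀
  let S : M → Fin k → EuclideanSpace ℝ (Fin m) := fun x i => mfderiv (𝓡 n) (𝓡 m) f x (s i x)
  have hS : ContinuousAt S x₀ := continuousAt_pi.2 fun i =>
    continuousAt_mfderiv_apply hf ((hs i).continuousAt (hU.mem_nhds hxU))
  have hS0 : LinearIndependent ℝ (S x₀) := by
    refine (hsD x₀ hxU).1.map_injOn (mfderiv (𝓡 n) (𝓡 m) f x₀).toLinearMap ?_
    rw [(hsD x₀ hxU).2]
    intro v hv w hw hvw
    have h1 := h0 (v - w) (sub_mem hv hw)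
      ((map_sub _ _ _).trans (sub_eq_zero.2 hvw))
    exact sub_eq_zero.1 h1
  have hev := hS.eventually (isOpen_setOfPred_linearIndependent.mem_nhds hS0)
  filter_upwards [hev, hU.mem_nhds hxU] with x hx hxU v hv hv0
  rw [← (hsD x hxU).2, Submodule.mem_span_range_iff_exists_fun] at hv
  obtain ⟨c, rfl⟩ := hv
  have h1 : ∑ i, c i • S x i = 0 := by
    refine Eq.trans (Eq.symm ((map_sum (mfderiv (𝓡 n) (𝓡 m) f x) _ _).trans ?_)) hv0
    exact Finset.sum_congr rfl fun i _ => map_smul _ _ _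
  have h2 := Fintype.linearIndependent_iff.1 hx c h1
  simp [h2]

namespace Foliation.IsTransverseFlow

variable {F : Foliation r k n M} {φ : Flow ℝ M} {X : ∀ x : M, TangentSpace (𝓡 n) x}

/-- Continuity of `X` comes from the flow: `X x` is the image of `(1, 0)` at `(0, x)` under the
tangent map of the smooth map `(t, x) ↦ φ t x`. -/
theorem continuous_vectorField (h : F.IsTransverseFlow φ X) :
    Continuous (fun x => (⟨x, X x⟩ : TangentBundle (𝓡 n) M)) := by
  have : IsManifold (𝓡 n) 1 M := IsManifold.of_le (n := ∞) (by simp)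
  have h1 := h.contMDiff.continuous_tangentMap (by simp)
  have h2 : Continuous fun x : M => ((⟨0, (1 : ℝ)⟩, ⟨x, 0⟩) :
      TangentBundle 𝓘(ℝ, ℝ) ℝ × TangentBundle (𝓡 n) M) :=
    continuous_const.prodMk
      (Bundle.contMDiff_zeroSection (n := 0) (IB := 𝓡 n) ℝ (TangentSpace (𝓡 n) : M → Type _)).continuous
  have h3 := h1.comp ((contMDiff_equivTangentBundleProd_symm (I := 𝓘(ℝ, ℝ)) (I' := 𝓡 n) (M := ℝ)
    (M' := M) (n := 0)).continuous.comp h2)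
  refine h3.congr fun x => ?_
  have h4 : mfderiv (𝓘(ℝ, ℝ).prod (𝓡 n)) (𝓡 n) (fun p : ℝ × M => φ p.1 p.2) (0, x)
      ((1 : ℝ), (0 : EuclideanSpace ℝ (Fin n))) = X (φ 0 x) := by
    refine (mfderiv_prod_eq_add_apply (h.contMDiff.mdifferentiable (by simp) _)).trans ?_
    refine Eq.trans (congrArg₂ (· + ·) (h.mfderiv_orbit x 0 1) (map_zero _)) ?_
    rw [one_smul, add_zero]
  have h5 : ∀ y, y = x → ∀ v : TangentSpace (𝓡 n) y, v = X y →
    (⟨y, v⟩ : TangentBundle (𝓡 n) M) = ⟨x, X x⟩ := by rintro _ rfl _ rfl; rfl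
  exact h5 _ (φ.map_zero_apply x) _ h4

theorem isContinuousSubbundle_sup_span (h : F.IsTransverseFlow φ X) (hF : F.IsIntegral) :
    IsContinuousSubbundle (k + 1) (fun x => F.tangentSpace x ⊔ Submodule.span ℝ {X x}) := by
  intro x₀
  obtain ⟨U, hU, hxU, s, hs, hsD⟩ := hF x₀
  refine ⟨U, hU, hxU, Fin.cons X s, fun i => ?_, fun x hx => ?_⟩
  · refine Fin.cases ?_ (fun i => ?_) i
    · exact h.continuous_vectorField.continuousOn
    · exact hs i
  · have h1 : (fun i => (Fin.cons X s : Fin (k + 1) → ∀ x : M, TangentSpace (𝓡 n) x) i x) =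
        (Fin.cons (X x) (fun i => s i x) : Fin (k + 1) → TangentSpace (𝓡 n) x) := by
      funext i
      refine Fin.cases rfl (fun i => rfl) i
    rw [h1]
    constructor
    · exact (hsD x hx).1.finCons (by rw [(hsD x hx).2]; exact h.notMem_tangentSpace x)
    · rw [Fin.range_cons, Submodule.span_insert, (hsD x hx).2, sup_comm]

end Foliation.IsTransverseFlow

end Subbundle

/-! ### Flow boxes adapted to the foliation at a point -/

section FlowBox

open Filter Topology Set

/-- A vector space is identified with a product, adapted to a subspace and a vector outside it. -/
theorem Submodule.exists_adapted_continuousLinearEquiv {V : Type*} [NormedAddCommGroup V]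
    [NormedSpace ℝ V] [FiniteDimensional ℝ V] {D : Submodule ℝ V} {x : V} (hx : x ∉ D) {k m : ℕ}
    (hk : Module.finrank ℝ D = k) (hm : Module.finrank ℝ V = k + 1 + m) :
    ∃ A : (ℝ × EuclideanSpace ℝ (Fin k) × EuclideanSpace ℝ (Fin m)) ≃L[ℝ] V,
      A (1, 0, 0) = x ∧ ∀ v ∈ D, ∃ a, A (0, a, 0) = v := by
  have hx0 : x ≠ 0 := fun h => hx (h ▸ zero_mem D)
  have hd : Disjoint D (Submodule.span ℝ {x}) := (Submodule.disjoint_span_singleton' hx0).2 hx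
  obtain ⟨Q, hQ⟩ := (D ⊔ Submodule.span ℝ {x}).exists_isCompl
  have h1 : Module.finrank ℝ (D ⊔ Submodule.span ℝ {x} : Submodule ℝ V) = k + 1 := by
    have := Submodule.finrank_sup_add_finrank_inf_eq D (Submodule.span ℝ {x})
    rwa [hd.eq_bot, finrank_bot, add_zero, hk, finrank_span_singleton hx0] at this
  have h2 : Module.finrank ℝ Q = m := by
    have := Submodule.finrank_add_eq_of_isCompl hQ
    omega
  let e₁ : EuclideanSpace ℝ (Fin k) ≃L[ℝ] D := ContinuousLinearEquiv.ofFinrankEq (by simp [hk])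
  let e₂ : EuclideanSpace ℝ (Fin m) ≃L[ℝ] Q := ContinuousLinearEquiv.ofFinrankEq (by simp [h2])
  let f : (ℝ × EuclideanSpace ℝ (Fin k) × EuclideanSpace ℝ (Fin m)) →ₗ[ℝ] V :=
    (LinearMap.toSpanSingleton ℝ V x).coprod
      ((D.subtype ∘ₗ e₁.toLinearMap).coprod (Q.subtype ∘ₗ e₂.toLinearMap))
  have hf : ∀ s a b, f (s, a, b) = s • x + (e₁ a + e₂ b) := fun s a b => rfl
  have hinj : Function.Injective f := by
    refine (injective_iff_map_eq_zero f).2 ?_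
    rintro ⟨s, a, b⟩ h
    rw [hf, ← add_assoc] at h
    have h3 : (e₂ b : V) = 0 := by
      refine Submodule.disjoint_def.1 hQ.disjoint _ ?_ (e₂ b).2
      rw [← neg_mem_iff, ← eq_neg_of_add_eq_zero_left h]
      exact add_mem (Submodule.mem_sup_right (Submodule.smul_mem _ _
        (Submodule.mem_span_singleton_self x))) (Submodule.mem_sup_left (e₁ a).2)
    rw [h3, add_zero] at h
    have h4 : (e₁ a : V) = 0 := by
      refine Submodule.disjoint_def.1 hd _ (e₁ a).2 ?_
      rw [← neg_mem_iff, ← eq_neg_of_add_eq_zero_left h]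
      exact Submodule.smul_mem _ _ (Submodule.mem_span_singleton_self x)
    rw [h4, add_zero, smul_eq_zero_iff_left hx0] at h
    rw [ZeroMemClass.coe_eq_zero, EmbeddingLike.map_eq_zero_iff] at h3 h4
    rw [h, h3, h4]; rfl
  let A := LinearEquiv.toContinuousLinearEquiv
    (LinearMap.linearEquivOfInjective f hinj (by simp [hm]; omega))
  have hA : ∀ z, A z = f z := fun z => rfl
  refine ⟨A, by simp [hA, hf], fun v hv => ⟨e₁.symm ⟨v, hv⟩, by simp [hA, hf]⟩⟩

variable {r : ℕ∞} {k n : ℕ} {M : Type u} [TopologicalSpace M]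
  [ChartedSpace (EuclideanSpace ℝ (Fin n)) M]

/-- Coordinates `(τ, α, β)` near `x₀` in which the flow `φ` is the translation of `τ` and the leaves
of `F` are transverse to the fibres of `α`. The map `σ` parametrizes `τ = 0, α = 0`. -/
structure Foliation.FlowBox (F : Foliation r k n M) (φ : Flow ℝ M) (x₀ : M) where
  τ : M → ℝ
  α : M → EuclideanSpace ℝ (Fin k)
  β : M → EuclideanSpace ℝ (Fin (n - (k + 1)))
  σ : EuclideanSpace ℝ (Fin (n - (k + 1))) → M
  τ_base : τ x₀ = 0
  α_base : α x₀ = 0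
  β_base : β x₀ = 0
  σ_zero : σ 0 = x₀
  contMDiffAt_τ : ∀ᶠ y in 𝓝 x₀, ContMDiffAt (𝓡 n) 𝓘(ℝ, ℝ) r τ y
  contMDiffAt_α : ∀ᶠ y in 𝓝 x₀, ContMDiffAt (𝓡 n) (𝓡 k) r α y
  continuousAt_β : ∀ᶠ y in 𝓝 x₀, ContinuousAt β y
  continuousAt_σ : ∀ᶠ b in 𝓝 0, ContinuousAt σ b
  flow : ∀ᶠ z : ℝ × M in 𝓝 (0, x₀), τ (φ z.1 z.2) = τ z.2 + z.1 ∧ α (φ z.1 z.2) = α z.2 ∧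
    β (φ z.1 z.2) = β z.2
  coord_σ : ∀ᶠ b in 𝓝 0, τ (σ b) = 0 ∧ α (σ b) = 0 ∧ β (σ b) = b
  σ_β : ∀ᶠ y in 𝓝 x₀, τ y = 0 → α y = 0 → σ (β y) = y
  mfderiv_α : ∀ᶠ y in 𝓝 x₀, ∀ v ∈ F.tangentSpace y, mfderiv (𝓡 n) (𝓡 k) α y v = 0 → v = 0

/-- Read in the preferred chart at `x₀`, the one `mfderiv` uses there, the map is a translation. -/
theorem hasMFDerivAt_extChartAt_symm_add (x₀ : M) :
    HasMFDerivAt (𝓡 n) (𝓡 n)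
      (fun w : EuclideanSpace ℝ (Fin n) => (extChartAt (𝓡 n) x₀).symm (extChartAt (𝓡 n) x₀ x₀ + w))
      0 (ContinuousLinearMap.id ℝ (EuclideanSpace ℝ (Fin n))) := by
  set c := extChartAt (𝓡 n) x₀
  have h0 : c.symm (c x₀ + 0) = x₀ := by rw [add_zero, extChartAt_to_inv]
  have hc : Continuous fun w : EuclideanSpace ℝ (Fin n) => c x₀ + w := by fun_prop
  refine ⟨?_, ?_⟩
  · refine ContinuousAt.comp (g := c.symm) ?_ hc.continuousAt
    rw [add_zero]
    exact continuousAt_extChartAt_symm x₀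
  · have h1 : c.target ∈ 𝓝 (c x₀ + 0) := by rw [add_zero]; exact extChartAt_target_mem_nhds x₀
    have key : HasFDerivAt (writtenInExtChartAt (𝓡 n) (𝓡 n) 0 fun w => c.symm (c x₀ + w))
        (ContinuousLinearMap.id ℝ (EuclideanSpace ℝ (Fin n))) 0 := by
      refine ((hasFDerivAt_id _).const_add (c x₀)).congr_of_eventuallyEq ?_
      filter_upwards [hc.continuousAt.eventually h1] with w hw
      simp only [writtenInExtChartAt, Function.comp_apply, h0, mfld_simps]
      exact c.right_inv hw
    exact key.hasFDerivWithinAt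

/-- Flow a linear slice complementary to `X x₀`: `Θ` sends `A (t, a, b)` to `φ t (χ (A (0, a, b)))`.
Its differential at `0` is invertible since that of `χ` is the identity, and the local inverse
provides the coordinates. As `A` parametrizes `T_{x₀}F` by `a`, the map `dα` is injective on it, and
stays so nearby by continuity of `TF`. -/
theorem Foliation.IsTransverseFlow.nonempty_flowBox [IsManifold (𝓡 n) ∞ M]
    {F : Foliation r k n M} {φ : Flow ℝ M} {X : ∀ x : M, TangentSpace (𝓡 n) x} (h : F.IsTransverseFlow φ X) (hr : 1 ≤ r)
    (hF : F.IsIntegral) (x₀ : M) : Nonempty (F.FlowBox φ x₀) := by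
  have hr0 : (r : WithTop ℕ∞) ≠ 0 := by simpa using (zero_lt_one.trans_le hr).ne'
  have hrt : (r : WithTop ℕ∞) ≤ ∞ := by exact_mod_cast le_top
  have : IsManifold (𝓡 n) r M := IsManifold.of_le (n := ∞) hrt
  have hkn : k + 1 ≤ n := by
    have : FiniteDimensional ℝ (TangentSpace (𝓡 n) x₀) :=
      inferInstanceAs (FiniteDimensional ℝ (EuclideanSpace ℝ (Fin n)))
    have h1 := Submodule.finrank_le (F.tangentSpace x₀ ⊔ Submodule.span ℝ {X x₀})
    rw [h.finrank_tangentSpace_sup_span] at h1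
    exact h1.trans_eq finrank_euclideanSpace_fin
  obtain ⟨A, hA1, hAD⟩ := Submodule.exists_adapted_continuousLinearEquiv
    (V := EuclideanSpace ℝ (Fin n)) (h.notMem_tangentSpace x₀) (m := n - (k + 1))
    (IsTransverseFlow.finrank_tangentSpace F x₀)
    (by simp only [finrank_euclideanSpace_fin]; omega)
  set B := A.symm
  set c := extChartAt (𝓡 n) x₀
  set χ := fun w : EuclideanSpace ℝ (Fin n) => c.symm (c x₀ + w)
  have hχ0 : χ 0 = x₀ := by simp only [χ]; rw [add_zero, extChartAt_to_inv]
  have hχd := hasMFDerivAt_extChartAt_symm_add (n := n) x₀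
  have hχs : ∀ᶠ w in 𝓝 0, ContMDiffAt (𝓡 n) (𝓡 n) ∞ χ w := by
    have hc : Continuous fun w : EuclideanSpace ℝ (Fin n) => c x₀ + w := by fun_prop
    have h1 : c.target ∈ 𝓝 (c x₀ + 0) := by rw [add_zero]; exact extChartAt_target_mem_nhds x₀
    filter_upwards [hc.continuousAt.eventually h1] with w hw
    have h2 : ContMDiffAt (𝓡 n) (𝓡 n) ∞ c.symm (c x₀ + w) :=
      (contMDiffOn_extChartAt_symm x₀).contMDiffAt
        ((isOpen_extChartAt_target (I := 𝓡 n) x₀).mem_nhds hw)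
    exact h2.comp w (contDiff_const.add contDiff_id).contMDiff.contMDiffAt
  let P : EuclideanSpace ℝ (Fin n) →L[ℝ] EuclideanSpace ℝ (Fin n) :=
    (A : _ →L[ℝ] EuclideanSpace ℝ (Fin n)).comp (((0 : _ →L[ℝ] ℝ).prod
      (ContinuousLinearMap.snd ℝ ℝ (EuclideanSpace ℝ (Fin k) ×
        EuclideanSpace ℝ (Fin (n - (k + 1)))))).comp B.toContinuousLinearMap)
  have hP : ∀ v, P v = A (0, (B v).2) := fun v => rfl
  have hPv : ∀ v, (B v).1 • (show EuclideanSpace ℝ (Fin n) from X x₀) + P v = v := by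
    intro v
    refine (congrArg (fun z : EuclideanSpace ℝ (Fin n) => (B v).1 • z + P v) hA1.symm).trans ?_
    rw [hP, ← map_smul, ← map_add]
    simp only [Prod.smul_mk, smul_zero, Prod.mk_add_mk, smul_eq_mul, mul_one, add_zero,
      ← Prod.zero_eq_mk, zero_add]
    exact A.apply_symm_apply v
  let Θ : EuclideanSpace ℝ (Fin n) → M := fun v => φ (B v).1 (χ (P v))
  have hΘ0 : Θ 0 = x₀ := by simp [Θ, hχ0, φ.map_zero_apply]
  have hB1 : ContMDiff (𝓡 n) 𝓘(ℝ, ℝ) ∞ (fun v => (B v).1) :=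
    (contDiff_fst.comp B.contDiff).contMDiff
  have hPt : Tendsto P (𝓝 0) (𝓝 0) := by
    have := P.continuous.tendsto 0
    rwa [map_zero] at this
  have hχP : ∀ᶠ v in 𝓝 0, ContMDiffAt (𝓡 n) (𝓡 n) ∞ (fun v => χ (P v)) v := by
    filter_upwards [hPt.eventually hχs] with v hv using hv.comp v P.contDiff.contMDiff.contMDiffAt
  have hΘs : ∀ᶠ v in 𝓝 0, ContMDiffAt (𝓡 n) (𝓡 n) r Θ v := by
    filter_upwards [hχP] with v hv
    exact (h.contMDiff.contMDiffAt.comp v ((hB1 v).prodMk hv)).of_le hrt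
  have hΘi : Function.Injective (mfderiv (𝓡 n) (𝓡 n) Θ 0) := by
    refine (injective_iff_map_eq_zero _).2 fun v hv => ?_
    have h1 : mfderiv (𝓡 n) 𝓘(ℝ, ℝ) (fun v => (B v).1) 0 v = (B v).1 := by
      have := ((ContinuousLinearMap.fst ℝ ℝ (EuclideanSpace ℝ (Fin k) ×
        EuclideanSpace ℝ (Fin (n - (k + 1))))).comp B.toContinuousLinearMap).hasMFDerivAt (x := 0)
      exact DFunLike.congr_fun this.mfderiv v
    have hχd' : HasMFDerivAt (𝓡 n) (𝓡 n) χ (P 0)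
        (ContinuousLinearMap.id ℝ (EuclideanSpace ℝ (Fin n))) := by
      rw [map_zero]; exact hχd
    have h2 : mfderiv (𝓡 n) (𝓡 n) (fun v => χ (P v)) 0 v = P v := by
      have := hχd'.comp 0 (P.hasMFDerivAt (x := 0))
      exact DFunLike.congr_fun this.mfderiv v
    have h3 := h.mfderiv_flow_comp ((hB1 0).mdifferentiableAt (by simp))
      (hχP.self_of_nhds.mdifferentiableAt (by simp)) h1
    have h4 := (injective_iff_map_eq_zero _).1 (h.injective_mfderiv_apply _ _) _ (h3.symm.trans hv)
    rw [h2] at h4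
    have h5 : ∀ y, y = x₀ → (show EuclideanSpace ℝ (Fin n) from X y) = X x₀ := by
      rintro _ rfl; rfl
    have h6 := h5 (χ (P 0)) (by rw [map_zero, hχ0])
    refine (hPv v).symm.trans (Eq.trans ?_ h4)
    exact congrArg (fun z : EuclideanSpace ℝ (Fin n) => (B v).1 • z + P v) h6.symm
  obtain ⟨l, hl, hlΘ, hΘl⟩ := exists_eventually_contMDiffAt_inverse hr0 hΘs hΘi
  rw [hΘ0] at hl hΘl
  have hl0 : l x₀ = 0 := by rw [← hΘ0]; exact hlΘ.self_of_nhds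
  have hlt : Tendsto l (𝓝 x₀) (𝓝 0) := by
    have := hl.self_of_nhds.continuousAt
    rwa [ContinuousAt, hl0] at this
  have hΘflow : ∀ v t, Θ (v + A (t, 0, 0)) = φ t (Θ v) := by
    intro v t
    have h1 : P (v + A (t, 0, 0)) = P v := by simp [hP, B]
    simp only [Θ, h1, ← φ.map_add]
    simp [B, add_comm]
  have hα : ∀ᶠ y in 𝓝 x₀, ContMDiffAt (𝓡 n) (𝓡 k) r (fun y => (B (l y)).2.1) y := by
    filter_upwards [hl] with y hy
    exact ((contDiff_fst.comp contDiff_snd).comp B.contDiff).contMDiff.contMDiffAt.comp y hy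
  have hσt : Tendsto (fun b : EuclideanSpace ℝ (Fin (n - (k + 1))) => A (0, 0, b))
      (𝓝 0) (𝓝 0) := by
    have h1 : Continuous fun b : EuclideanSpace ℝ (Fin (n - (k + 1))) => A (0, 0, b) := by fun_prop
    have := h1.tendsto 0
    rwa [← Prod.zero_eq_mk, ← Prod.zero_eq_mk, map_zero] at this
  refine ⟨{
    τ := fun y => (B (l y)).1
    α := fun y => (B (l y)).2.1
    β := fun y => (B (l y)).2.2
    σ := fun b => Θ (A (0, 0, b))
    τ_base := by simp [hl0]
    α_base := by simp [hl0]
    β_base := by simp [hl0]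
    σ_zero := by rw [← Prod.zero_eq_mk, ← Prod.zero_eq_mk, map_zero, hΘ0]
    contMDiffAt_τ := by
      filter_upwards [hl] with y hy
      exact (contDiff_fst.comp B.contDiff).contMDiff.contMDiffAt.comp y hy
    contMDiffAt_α := hα
    continuousAt_β := by
      filter_upwards [hl] with y hy
      have h1 : Continuous fun v => (B v).2.2 := by fun_prop
      exact h1.continuousAt.comp hy.continuousAt
    continuousAt_σ := by
      filter_upwards [hσt.eventually hΘs] with b hb
      have h1 : Continuous fun b : EuclideanSpace ℝ (Fin (n - (k + 1))) => A (0, 0, b) := by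
        fun_prop
      exact ContinuousAt.comp (g := Θ) hb.continuousAt h1.continuousAt
    flow := ?_
    coord_σ := by
      filter_upwards [hσt.eventually hlΘ] with b hb
      simp [hb, B]
    σ_β := by
      filter_upwards [hΘl] with y hy h1 h2
      have h3 : A (0, 0, (B (l y)).2.2) = l y := by
        rw [← h1, ← h2]
        exact A.apply_symm_apply _
      rw [h3, hy]
    mfderiv_α := ?_ }⟩
  · have h1 : Tendsto (fun z : ℝ × M => l z.2 + A (z.1, 0, 0)) (𝓝 (0, x₀)) (𝓝 0) := by
      have h2 : Tendsto (fun z : ℝ × M => l z.2) (𝓝 (0, x₀)) (𝓝 0) :=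
        hlt.comp continuous_snd.continuousAt
      have h3 : Continuous fun z : ℝ × M => A (z.1, 0, 0) := by fun_prop
      have h4 := h2.add (h3.tendsto (0, x₀))
      simpa [← Prod.zero_eq_mk] using h4
    filter_upwards [h1.eventually hlΘ, continuous_snd.continuousAt.eventually hΘl] with z hz hz'
    rw [hΘflow, hz'] at hz
    simp [hz, B]
  · refine IsContinuousSubbundle.eventually_mfderiv_injective hF
      (hα.mono fun y hy => hy.of_le (by exact_mod_cast hr)) fun v hv hv0 => ?_
    obtain ⟨a, rfl⟩ := hAD v hv
    let Q : EuclideanSpace ℝ (Fin k) →L[ℝ] EuclideanSpace ℝ (Fin n) :=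
      A.toContinuousLinearMap.comp ((ContinuousLinearMap.inr ℝ ℝ (EuclideanSpace ℝ (Fin k) ×
        EuclideanSpace ℝ (Fin (n - (k + 1))))).comp (ContinuousLinearMap.inl ℝ _ _))
    have hQ : ∀ a, Q a = A (0, a, 0) := fun a => rfl
    have hχQ : HasMFDerivAt (𝓡 n) (𝓡 n) χ (Q 0)
        (ContinuousLinearMap.id ℝ (EuclideanSpace ℝ (Fin n))) := by
      rw [map_zero]; exact hχd
    have h1 := hχQ.comp 0 (Q.hasMFDerivAt (x := 0))
    have hαQ : HasMFDerivAt (𝓡 n) (𝓡 k) (fun y => (B (l y)).2.1) (χ (Q 0))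
        (mfderiv (𝓡 n) (𝓡 k) (fun y => (B (l y)).2.1) x₀) := by
      have h2 : χ (Q 0) = x₀ := by rw [map_zero, hχ0]
      rw [h2]
      exact (hα.self_of_nhds.mdifferentiableAt hr0).hasMFDerivAt
    have h3 := hαQ.comp 0 h1
    have hQt : Tendsto Q (𝓝 0) (𝓝 0) := by
      have := Q.continuous.tendsto 0
      rwa [map_zero] at this
    -- `Θ` and `χ` agree on the range of `Q`, where the time coordinate vanishes, so `α` inverts `χ
    -- ∘ Q`.
    have h4 : (fun y => (B (l y)).2.1) ∘ χ ∘ Q =ᶠ[𝓝 0] id := by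
      filter_upwards [hQt.eventually hlΘ] with a ha
      have h5 : Θ (Q a) = χ (Q a) := by
        simp [Θ, hP, hQ, B, φ.map_zero_apply]
      rw [h5] at ha
      simp only [Function.comp_apply, ha]
      simp [hQ, B]
    have h6 := (hasMFDerivAt_unique (h3.congr_of_eventuallyEq h4.symm) (hasMFDerivAt_id 0))
    have h7 := (DFunLike.congr_fun h6 a).symm.trans hv0
    change a = 0 at h7
    rw [h7, ← Prod.zero_eq_mk, ← Prod.zero_eq_mk]
    exact map_zero A

end FlowBox

/-! ### A criterion for foliated charts -/

section FoliatedChartCriterion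

open Filter Topology Set

variable {r : ℕ∞} {k n : ℕ} {M : Type u} [TopologicalSpace M]
  [ChartedSpace (EuclideanSpace ℝ (Fin n)) M] {ι : Type u}
  {leaf : ι → ImmersedSubmanifold r k n M}
  {ψ : OpenPartialHomeomorph M (EuclideanSpace ℝ (Fin k) × EuclideanSpace ℝ (Fin (n - k)))}
  {U₁ : Set (EuclideanSpace ℝ (Fin k))} {U₂ : Set (EuclideanSpace ℝ (Fin (n - k)))}

/-- A chart is foliated if its transverse coordinate is locally constant on the leaves, if its
slices lift to the leaves, and if its first component is an immersion on the leaves. -/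
theorem IsFoliatedChart.of_exists_lift (hr : 1 ≤ r) (hU₁ : IsOpen U₁) (hU₂ : IsOpen U₂)
    (hU₁c : IsConnected U₁) (hU₂c : IsConnected U₂) (hψ : ψ.target = U₁ ×ˢ U₂)
    (hloc : ∀ a (p : (leaf a).Pt), (leaf a).incl p ∈ ψ.source →
      ∀ᶠ q in 𝓝 p, (ψ ((leaf a).incl q)).2 = (ψ ((leaf a).incl p)).2)
    (hlift : ∀ a (p : (leaf a).Pt), (leaf a).incl p ∈ ψ.source →
      ∃ H : EuclideanSpace ℝ (Fin k) → (leaf a).Pt, ContinuousOn H U₁ ∧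
        ∀ u ∈ U₁, (leaf a).incl (H u) = ψ.symm (u, (ψ ((leaf a).incl p)).2))
    (hsmooth : ∀ y ∈ ψ.source, ContMDiffAt (𝓡 n) (𝓡 k) r (fun y => (ψ y).1) y)
    (himm : ∀ a (p : (leaf a).Pt), (leaf a).incl p ∈ ψ.source →
      ∀ v ∈ (mfderiv (𝓡 k) (𝓡 n) (leaf a).incl p).range,
        mfderiv (𝓡 n) (𝓡 k) (fun y => (ψ y).1) ((leaf a).incl p) v = 0 → v = 0) :
    IsFoliatedChart leaf ψ U₁ U₂ := by
  have hr0 : (r : WithTop ℕ∞) ≠ 0 := by simpa using (zero_lt_one.trans_le hr).ne'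
  refine ⟨hU₁, hU₂, hU₁c, hU₂c, hψ, fun a p hp => ?_⟩
  set S := (leaf a).incl ⁻¹' ψ.source
  set C := connectedComponentIn S p
  set c := (ψ ((leaf a).incl p)).2
  have hS : IsOpen S := ψ.open_source.preimage (leaf a).continuous_incl
  have hCo : IsOpen C := (leaf a).isOpen_connectedComponentIn ψ.open_source p
  have hpC : p ∈ C := mem_connectedComponentIn hp
  have hCS : C ⊆ S := connectedComponentIn_subset S p
  obtain ⟨H, hHc, hH⟩ := hlift a p hp
  have hfst : ∀ y ∈ ψ.source, (ψ y).1 ∈ U₁ := fun y hy => by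
    have := ψ.map_source hy
    rw [hψ] at this
    exact this.1
  have hc : c ∈ U₂ := by
    have := ψ.map_source hp
    rw [hψ] at this
    exact this.2
  have hsnd : ∀ q ∈ C, (ψ ((leaf a).incl q)).2 = c := by
    have h1 : ∀ P : EuclideanSpace ℝ (Fin (n - k)) → Prop,
        IsOpen {q | q ∈ S ∧ P (ψ ((leaf a).incl q)).2} := fun P => by
      refine isOpen_iff_mem_nhds.2 fun q hq => ?_
      filter_upwards [hS.mem_nhds hq.1, hloc a q hq.1] with q' hq' h
      exact ⟨hq', by rw [h]; exact hq.2⟩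
    have h2 := isPreconnected_connectedComponentIn.subset_left_of_subset_union (s := C)
      (h1 (· = c)) (h1 (· ≠ c)) (by
        rw [disjoint_left]
        exact fun q hq hq' => hq'.2 hq.2) (fun q hq => by
        by_cases h : (ψ ((leaf a).incl q)).2 = c
        · exact Or.inl ⟨hCS hq, h⟩
        · exact Or.inr ⟨hCS hq, h⟩) ⟨p, hpC, hp, rfl⟩
    exact fun q hq => (h2 hq).2
  have hHf : ∀ q ∈ C, H (ψ ((leaf a).incl q)).1 = q := fun q hq => by
    refine (leaf a).injective_incl ?_
    rw [hH _ (hfst _ (hCS hq)), show (ψ ((leaf a).incl p)).2 = _ from (hsnd q hq).symm]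
    exact ψ.left_inv (hCS hq)
  have hsymm : ∀ u ∈ U₁, (u, c) ∈ ψ.target := fun u hu => by rw [hψ]; exact ⟨hu, hc⟩
  have hψH : ∀ u ∈ U₁, ψ ((leaf a).incl (H u)) = (u, c) := fun u hu => by
    rw [hH u hu]
    exact ψ.right_inv (hsymm u hu)
  -- The lifted slice is connected, contains `p` and stays over `ψ.source`, hence lies in the
  -- component of `p`.
  have hHC : MapsTo H U₁ C := by
    have h1 : H '' U₁ ⊆ C := by
      refine (hU₁c.isPreconnected.image H hHc).subset_connectedComponentIn
        ⟨_, hfst _ hp, hHf p hpC⟩ ?_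
      rintro _ ⟨u, hu, rfl⟩
      change (leaf a).incl (H u) ∈ ψ.source
      rw [hH u hu]
      exact ψ.map_target (hsymm u hu)
    exact mapsTo_iff_image_subset.2 h1
  refine ⟨⟨c, ?_⟩, ?_⟩
  · ext ⟨u, c'⟩
    constructor
    · rintro ⟨q, hq, hqu⟩
      have h1 := hsnd q hq
      have h2 := hfst _ (hCS hq)
      rw [show ψ ((leaf a).incl q) = (u, c') from hqu] at h1 h2
      exact ⟨h2, h1⟩
    · rintro ⟨hu, hcc⟩
      obtain rfl : c' = c := hcc
      exact ⟨H u, hHC hu, hψH u hu⟩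
  have hf : ContinuousOn (fun q => (ψ ((leaf a).incl q)).1) C :=
    continuous_fst.comp_continuousOn
      (ψ.continuousOn.comp (leaf a).continuous_incl.continuousOn fun q hq => hCS hq)
  have hfs : ∀ q ∈ S, ContMDiffAt (𝓡 k) (𝓡 k) r (fun q => (ψ ((leaf a).incl q)).1) q := fun q hq =>
    (hsmooth _ hq).comp q ((leaf a).contMDiff_incl q)
  let e : OpenPartialHomeomorph (leaf a).Pt (EuclideanSpace ℝ (Fin k)) :=
    { toFun := fun q => (ψ ((leaf a).incl q)).1
      invFun := H
      source := C
      target := U₁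
      map_source' := fun q hq => hfst _ (hCS hq)
      map_target' := hHC
      left_inv' := hHf
      right_inv' := fun u hu => by rw [hψH u hu]
      open_source := hCo
      open_target := hU₁
      continuousOn_toFun := hf
      continuousOn_invFun := hHc }
  refine ⟨e, mem_maximalAtlas_of_contMDiffAt (fun q hq => hfs q (hCS hq)) fun u hu => ?_, rfl,
    fun q _ => rfl⟩
  have hu' : H u ∈ S := hCS (hHC hu)
  have hinj : Function.Injective (mfderiv (𝓡 k) (𝓡 k) (fun q => (ψ ((leaf a).incl q)).1) (H u)) := by
    have h1 : mfderiv (𝓡 k) (𝓡 k) (fun q => (ψ ((leaf a).incl q)).1) (H u) =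
        (mfderiv (𝓡 n) (𝓡 k) (fun y => (ψ y).1) ((leaf a).incl (H u))).comp
          (mfderiv (𝓡 k) (𝓡 n) (leaf a).incl (H u)) :=
      mfderiv_comp (H u) ((hsmooth _ hu').mdifferentiableAt hr0)
        ((leaf a).contMDiff_incl.mdifferentiable hr0 _)
    refine (injective_iff_map_eq_zero _).2 fun v hv => ?_
    rw [h1] at hv
    exact (injective_iff_map_eq_zero _).1 ((leaf a).injective_mfderiv (H u)) v
      (himm a (H u) hu' _ ⟨v, rfl⟩ hv)
  -- The first component of `ψ` is an immersion on the leaf, so near `u` the continuous inverse `H`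
  -- coincides with a `C^r` left inverse.
  obtain ⟨l, hl, hlf⟩ := exists_eventually_contMDiffAt_leftInverse hr0
    (by filter_upwards [hS.mem_nhds hu'] with q hq using hfs q hq) hinj
  have hul : ContMDiffAt (𝓡 k) (𝓡 k) r l u := by
    have := hl.self_of_nhds
    rwa [hψH u hu] at this
  refine hul.congr_of_eventuallyEq ?_
  filter_upwards [hU₁.mem_nhds hu, (hHc.continuousAt (hU₁.mem_nhds hu)).eventually hlf]
    with u' hu' h1
  rw [hψH u' hu'] at h1
  exact h1.symm

end FoliatedChartCriterion

/-! ### Changing the plaque coordinate of a foliated chart -/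

section StraightenedChart

open Filter Topology Set Metric

theorem OpenPartialHomeomorph.exists_target_eq {X Y : Type*} [TopologicalSpace X]
    [TopologicalSpace Y] (e : OpenPartialHomeomorph X Y) {T : Set Y} (hT : IsOpen T)
    (hTe : T ⊆ e.target) : ∃ e' : OpenPartialHomeomorph X Y, e'.source = e.source ∩ e ⁻¹' T ∧
      e'.target = T ∧ (∀ x, e' x = e x) ∧ ∀ y, e'.symm y = e.symm y := by
  refine ⟨(e.symm.restrOpen T hT).symm, ?_, ?_, fun _ => rfl, fun _ => rfl⟩
  · ext x
    simp
  · simpa using hTe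

variable {r : ℕ∞} {k n : ℕ} {M : Type u} [TopologicalSpace M]
  [ChartedSpace (EuclideanSpace ℝ (Fin n)) M] {F : Foliation r k n M}
  {ψ : OpenPartialHomeomorph M (EuclideanSpace ℝ (Fin k) × EuclideanSpace ℝ (Fin (n - k)))}
  {U₁ : Set (EuclideanSpace ℝ (Fin k))} {U₂ : Set (EuclideanSpace ℝ (Fin (n - k)))}

/-- The first component of a foliated chart can be replaced by any smooth map which is an immersion
on the leaves. -/
theorem IsFoliatedChart.exists_openPartialHomeomorph (hψ : IsFoliatedChart F.leaf ψ U₁ U₂)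
    (hr : 1 ≤ r) {x₀ : M} (hx₀ : x₀ ∈ ψ.source) {α : M → EuclideanSpace ℝ (Fin k)}
    (hα : ∀ᶠ y in 𝓝 x₀, ContMDiffAt (𝓡 n) (𝓡 k) r α y)
    (hα' : ∀ᶠ y in 𝓝 x₀, ∀ v ∈ F.tangentSpace y, mfderiv (𝓡 n) (𝓡 k) α y v = 0 → v = 0)
    {G : Set M} (hG : G ∈ 𝓝 x₀) :
    ∃ Γ : OpenPartialHomeomorph M (EuclideanSpace ℝ (Fin k) × EuclideanSpace ℝ (Fin (n - k))),
      ∃ δ > 0, ∃ V, x₀ ∈ Γ.source ∧ Γ.source ⊆ G ∩ ψ.source ∧ Γ.target = ball (α x₀) δ ×ˢ V ∧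
        ∀ y ∈ Γ.source, Γ y = (α y, (ψ y).2) := by
  have hr0 : (r : WithTop ℕ∞) ≠ 0 := by simpa using (zero_lt_one.trans_le hr).ne'
  obtain ⟨A, hA, hAo, hxA⟩ := mem_nhds_iff.1 (hα.and hα')
  set O := ψ.target ∩ ψ.symm ⁻¹' A
  have hO : IsOpen O := ψ.isOpen_inter_preimage_symm hAo
  have hcont : ContinuousOn (fun p => α (ψ.symm p)) O := fun p hp =>
    ((hA hp.2).1.continuousAt.comp (ψ.continuousAt_symm hp.1)).continuousWithinAt
  -- Within one plaque, `α` read in the leaf chart `e` is a `C^r` immersion between spaces of equal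
  -- dimension, hence a local homeomorphism.
  have hloc : ∀ p ∈ O, ∃ e : OpenPartialHomeomorph (EuclideanSpace ℝ (Fin k))
      (EuclideanSpace ℝ (Fin k)), p.1 ∈ e.source ∧
        EqOn (fun u => α (ψ.symm (u, p.2))) e e.source := by
    rintro ⟨u, c⟩ ⟨hp, hpA⟩
    obtain ⟨b, q, hq⟩ : ∃ b q, (F.leaf b).incl q = ψ.symm (u, c) := ⟨_, _, F.incl_leafPoint _⟩
    have hqs : (F.leaf b).incl q ∈ ψ.source := by rw [hq]; exact ψ.map_target hp
    have hψq : ψ ((F.leaf b).incl q) = (u, c) := by rw [hq]; exact ψ.right_inv hp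
    obtain ⟨-, e, he, hes, heq⟩ := hψ.plaque b q hqs
    have hqe : q ∈ e.source := by rw [hes]; exact mem_connectedComponentIn hqs
    have hequ : e q = u := by rw [heq q hqe, hψq]
    have hut : u ∈ e.target := hequ ▸ e.map_source hqe
    have hequ' : e.symm u = q := by rw [← hequ, e.left_inv hqe]
    have hincl : ∀ v ∈ e.target, (F.leaf b).incl (e.symm v) = ψ.symm (v, c) := by
      intro v hv
      have h1 := e.map_target hv
      have h2 := h1
      rw [hes] at h2
      have h3 : ψ ((F.leaf b).incl (e.symm v)) = (v, c) := by
        refine Prod.ext ?_ ?_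
        · rw [← heq _ h1, e.right_inv hv]
        · rw [hψ.snd_eq_of_mem_plaque hqs h2, hψq]
      rw [← h3, ψ.left_inv (show (F.leaf b).incl (e.symm v) ∈ ψ.source from
        connectedComponentIn_subset ((F.leaf b).incl ⁻¹' ψ.source) q h2)]
    have hes' : ∀ v ∈ e.target, ContMDiffAt (𝓡 k) (𝓡 n) r
        (fun v => (F.leaf b).incl (e.symm v)) v := fun v hv =>
      (F.leaf b).contMDiff_incl.contMDiffAt.comp v (contMDiffAt_symm_of_mem_maximalAtlas he hv)
    have hgs : ∀ᶠ v in 𝓝 u, ContMDiffAt (𝓡 k) (𝓡 k) r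
        (fun v => α ((F.leaf b).incl (e.symm v))) v := by
      have h1 : (F.leaf b).incl (e.symm u) ∈ A := by rw [hincl u hut]; exact hpA
      filter_upwards [e.open_target.mem_nhds hut,
        (hes' u hut).continuousAt.preimage_mem_nhds (hAo.mem_nhds h1)] with v hv hvA
      exact (hA hvA).1.comp v (hes' v hv)
    have hinj : Function.Injective
        (mfderiv (𝓡 k) (𝓡 k) (fun v => α ((F.leaf b).incl (e.symm v))) u) := by
      have hqA : (F.leaf b).incl (e.symm u) ∈ A := by rw [hincl u hut]; exact hpA
      have hse := contMDiffAt_symm_of_mem_maximalAtlas he hut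
      have h1 : mfderiv (𝓡 k) (𝓡 k) (fun v => α ((F.leaf b).incl (e.symm v))) u =
          (mfderiv (𝓡 n) (𝓡 k) α ((F.leaf b).incl (e.symm u))).comp
            (mfderiv (𝓡 k) (𝓡 n) (fun v => (F.leaf b).incl (e.symm v)) u) :=
        mfderiv_comp u ((hA hqA).1.mdifferentiableAt hr0) ((hes' u hut).mdifferentiableAt hr0)
      have h2 : mfderiv (𝓡 k) (𝓡 n) (fun v => (F.leaf b).incl (e.symm v)) u =
          (mfderiv (𝓡 k) (𝓡 n) (F.leaf b).incl (e.symm u)).comp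
            (mfderiv (𝓡 k) (𝓡 k) e.symm u) :=
        mfderiv_comp u ((F.leaf b).contMDiff_incl.mdifferentiable hr0 _)
          (hse.mdifferentiableAt hr0)
      refine (injective_iff_map_eq_zero _).2 fun v hv => ?_
      rw [h1, h2] at hv
      have h3 := (hA hqA).2 _ (by rw [F.tangentSpace_incl]; exact ⟨_, rfl⟩) hv
      have h4 := (injective_iff_map_eq_zero _).1 ((F.leaf b).injective_mfderiv _) _ h3
      exact (injective_iff_map_eq_zero _).1 (injective_mfderiv_of_eventually_leftInverse
        (hse.mdifferentiableAt hr0) ((contMDiffAt_of_mem_maximalAtlas he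
          (e.map_target hut)).mdifferentiableAt hr0) (by
          filter_upwards [e.open_target.mem_nhds hut] with u' hu' using e.right_inv hu')) _ h4
    obtain ⟨l, hl, hlg, hgl⟩ := exists_eventually_contMDiffAt_inverse hr0 hgs hinj
    obtain ⟨e', hue', he', -⟩ := exists_openPartialHomeomorph_of_eventually_inverse
      (hgs.mono fun v hv => hv.continuousAt) (hl.mono fun v hv => hv.continuousAt) hlg hgl
    refine ⟨e'.restrOpen e.target e.open_target, ⟨hue', hut⟩, fun v hv => ?_⟩
    have h1 : v ∈ e'.source ∧ v ∈ e.target := by simpa using hv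
    change α (ψ.symm (v, c)) = e' v
    rw [he', hincl v h1.2]
  -- Across plaques `α ∘ ψ.symm` is only continuous, so the local homeomorphisms on the plaques are
  -- assembled topologically.
  obtain ⟨Γ₀, hΓ₀, hΓ₀O, hΓ₀f⟩ := exists_openPartialHomeomorph_prodMk_snd hO hcont hloc
    (p := ψ x₀) ⟨ψ.map_source hx₀, by rwa [mem_preimage, ψ.left_inv hx₀]⟩
  set Γ₁ := ψ ≫ₕ Γ₀
  have hΓ₁ : ∀ y ∈ ψ.source, Γ₁ y = (α y, (ψ y).2) := fun y hy => by
    simp [Γ₁, hΓ₀f, ψ.left_inv hy]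
  have hx₁ : x₀ ∈ Γ₁.source := by simp [Γ₁, hx₀, hΓ₀]
  have hΓ₁ψ : Γ₁.source ⊆ ψ.source := fun y hy => by
    rw [OpenPartialHomeomorph.trans_source] at hy
    exact hy.1
  have hnhds : Γ₁.target ∩ Γ₁.symm ⁻¹' G ∈ 𝓝 (Γ₁ x₀) := by
    refine inter_mem (Γ₁.open_target.mem_nhds (Γ₁.map_source hx₁)) ?_
    refine (Γ₁.continuousAt_symm (Γ₁.map_source hx₁)).preimage_mem_nhds ?_
    rwa [Γ₁.left_inv hx₁]
  obtain ⟨δ, hδ, hδT⟩ := Metric.mem_nhds_iff.1 hnhds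
  obtain ⟨Γ, hΓs, hΓt, hΓ, -⟩ := Γ₁.exists_target_eq isOpen_ball (hδT.trans inter_subset_left)
  refine ⟨Γ, δ, hδ, ball (ψ x₀).2 δ, ?_, fun y hy => ?_, ?_, fun y hy => ?_⟩
  · rw [hΓs]
    exact ⟨hx₁, mem_ball_self hδ⟩
  · rw [hΓs] at hy
    refine ⟨?_, hΓ₁ψ hy.1⟩
    have := (hδT hy.2).2
    rwa [mem_preimage, Γ₁.left_inv hy.1] at this
  · rw [hΓt, hΓ₁ x₀ hx₀, ball_prod_same]
  · rw [hΓs] at hy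
    rw [hΓ, hΓ₁ y (hΓ₁ψ hy.1)]

end StraightenedChart

/-! ### Plaques under the flow, and the immersion condition -/

section SaturatedChart

open Filter Topology Set Metric

variable {r : ℕ∞} {k n : ℕ} {M : Type u} [TopologicalSpace M]
  [ChartedSpace (EuclideanSpace ℝ (Fin n)) M] {F : Foliation r k n M} {φ : Flow ℝ M}
  {X : ∀ x : M, TangentSpace (𝓡 n) x}
  {ψ Γ : OpenPartialHomeomorph M (EuclideanSpace ℝ (Fin k) × EuclideanSpace ℝ (Fin (n - k)))}
  {U₁ : Set (EuclideanSpace ℝ (Fin k))} {U₂ : Set (EuclideanSpace ℝ (Fin (n - k)))}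
  {B : Set (EuclideanSpace ℝ (Fin k))} {V : Set (EuclideanSpace ℝ (Fin (n - k)))}

theorem IsFoliatedChart.exists_incl_eq (hψ : IsFoliatedChart F.leaf ψ U₁ U₂) {y : M}
    (hy : y ∈ ψ.source) : ∃ b : F.ι, ∀ z ∈ ψ.source, (ψ z).2 = (ψ y).2 →
      ∃ q, (F.leaf b).incl q = z := by
  refine ⟨F.leafIndex y, fun z hz hzy => ?_⟩
  obtain ⟨q, -, hq⟩ := hψ.exists_mem_plaque_of_snd_eq (a := F.leafIndex y) (p := F.leafPoint y)
    (by rwa [F.incl_leafPoint]) hz (by rwa [F.incl_leafPoint])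
  exact ⟨q, hq⟩

/-- The flow maps points of a plaque to points of a plaque. -/
theorem Foliation.IsTransverseFlow.snd_apply_eq (h : F.IsTransverseFlow φ X)
    (hψ : IsFoliatedChart F.leaf ψ U₁ U₂) {α : M → EuclideanSpace ℝ (Fin k)}
    (hB : IsPreconnected B) (hΓψ : Γ.source ⊆ ψ.source) (hΓt : Γ.target = B ×ˢ V)
    (hΓ : ∀ y ∈ Γ.source, Γ y = (α y, (ψ y).2)) {t : ℝ} (ht : MapsTo (φ t) Γ.source ψ.source)
    {y y' : M} (hy : y ∈ Γ.source) (hy' : y' ∈ Γ.source) (hyy : (ψ y).2 = (ψ y').2) :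
    (ψ (φ t y)).2 = (ψ (φ t y')).2 := by
  have hmem : ∀ z ∈ Γ.source, α z ∈ B ∧ (ψ z).2 ∈ V := fun z hz => by
    have := Γ.map_source hz
    rwa [hΓt, hΓ z hz] at this
  set s : EuclideanSpace ℝ (Fin k) → M := fun u => Γ.symm (u, (ψ y).2)
  have ht' : ∀ u ∈ B, (u, (ψ y).2) ∈ Γ.target := fun u hu => by
    rw [hΓt]; exact ⟨hu, (hmem y hy).2⟩
  have hs : ∀ u ∈ B, s u ∈ Γ.source := fun u hu => Γ.map_target (ht' u hu)
  have hs' : ∀ u ∈ B, (ψ (s u)).2 = (ψ y).2 := fun u hu => by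
    have := Γ.right_inv (ht' u hu)
    rw [hΓ _ (hs u hu)] at this
    exact (Prod.ext_iff.1 this).2
  have hsy : s (α y) = y := by
    simp only [s]
    rw [← hΓ y hy, Γ.left_inv hy]
  have hsy' : s (α y') = y' := by
    simp only [s]
    rw [hyy, ← hΓ y' hy', Γ.left_inv hy']
  obtain ⟨b, hb⟩ := hψ.exists_incl_eq (hΓψ hy)
  obtain ⟨q, hq⟩ := hb y (hΓψ hy) rfl
  obtain ⟨g, -, hg⟩ := h.exists_continuous_lift (a := b) (p := q) (t := t)
    (F.incl_leafPoint (φ t ((F.leaf b).incl q))).symm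
  have hc : ContinuousOn (fun u => φ t (s u)) B := by
    refine (φ.continuous continuous_const continuous_id).comp_continuousOn
      (Γ.symm.continuousOn.comp (by fun_prop) ht')
  -- The slice `s` joins `y` to `y'` inside one leaf; its image under `φ t` is connected and lies in
  -- a single leaf, so its transverse coordinate is constant.
  have key := hψ.snd_eq_of_isPreconnected hB hc (fun u hu => ht (hs u hu))
    (fun u hu => by
      obtain ⟨q', hq'⟩ := hb _ (hΓψ (hs u hu)) (hs' u hu)
      exact ⟨g q', by rw [hg, hq']⟩) (hmem y hy).1 (hmem y' hy').1
  rwa [hsy, hsy'] at key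

/-- A map with components `τ` and `α` is an immersion on the saturated leaves if the flow is the
translation of `τ` and preserves `α`. -/
theorem Foliation.IsTransverseFlow.eq_zero_of_mfderiv_eq_zero (h : F.IsTransverseFlow φ X)
    (ε : EuclideanSpace ℝ (Fin (k + 1)) ≃L[ℝ] (ℝ × EuclideanSpace ℝ (Fin k)))
    {τ : M → ℝ} {α : M → EuclideanSpace ℝ (Fin k)} {y : M}
    (hτ : MDifferentiableAt (𝓡 n) 𝓘(ℝ, ℝ) τ y) (hα : MDifferentiableAt (𝓡 n) (𝓡 k) α y)
    (hα' : ∀ v ∈ F.tangentSpace y, mfderiv (𝓡 n) (𝓡 k) α y v = 0 → v = 0)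
    (hφ : ∀ᶠ t : ℝ in 𝓝 0, τ (φ t y) = τ y + t ∧ α (φ t y) = α y)
    {v : TangentSpace (𝓡 n) y} (hv : v ∈ F.tangentSpace y ⊔ Submodule.span ℝ {X y})
    (hv0 : mfderiv (𝓡 n) (𝓡 (k + 1)) (fun y => ε.symm (τ y, α y)) y v = 0) : v = 0 := by
  have hj : MDifferentiableAt (𝓡 n) (𝓡 (k + 1)) (fun y => ε.symm (τ y, α y)) y := by
    have h1 : MDifferentiableAt (𝓡 n) 𝓘(ℝ, ℝ × EuclideanSpace ℝ (Fin k))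
        (fun y => (τ y, α y)) y := hτ.prodMk_space hα
    exact ε.symm.differentiableAt.mdifferentiableAt.comp y h1
  have hτv : mfderiv (𝓡 n) 𝓘(ℝ, ℝ) τ y v = (0 : ℝ) := by
    have h1 := (((ContinuousLinearMap.fst ℝ ℝ (EuclideanSpace ℝ (Fin k))).comp
      ε.toContinuousLinearMap).hasMFDerivAt (x := ε.symm (τ y, α y))).comp y hj.hasMFDerivAt
    have h2 := hasMFDerivAt_unique (h1.congr_of_eventuallyEq (f₁ := τ)
      (Eventually.of_forall fun z => by simp)) hτ.hasMFDerivAt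
    refine (DFunLike.congr_fun h2 v).symm.trans ?_
    refine (congrArg (fun z => (ε z).1) hv0).trans ?_
    exact congrArg Prod.fst (map_zero ε)
  have hαv : mfderiv (𝓡 n) (𝓡 k) α y v = 0 := by
    have h1 := (((ContinuousLinearMap.snd ℝ ℝ (EuclideanSpace ℝ (Fin k))).comp
      ε.toContinuousLinearMap).hasMFDerivAt (x := ε.symm (τ y, α y))).comp y hj.hasMFDerivAt
    have h2 := hasMFDerivAt_unique (h1.congr_of_eventuallyEq (f₁ := α)
      (Eventually.of_forall fun z => by simp)) hα.hasMFDerivAt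
    refine (DFunLike.congr_fun h2 v).symm.trans ?_
    refine (congrArg (fun z => (ε z).2) hv0).trans ?_
    exact congrArg Prod.snd (map_zero ε)
  have h0 := h.isMIntegralCurve y 0
  have hφ0 : φ 0 y = y := φ.map_zero_apply y
  have hτ' : HasMFDerivAt (𝓡 n) 𝓘(ℝ, ℝ) τ (φ 0 y) (mfderiv (𝓡 n) 𝓘(ℝ, ℝ) τ (φ 0 y)) := by
    rw [hφ0]; exact hτ.hasMFDerivAt
  have hα'' : HasMFDerivAt (𝓡 n) (𝓡 k) α (φ 0 y) (mfderiv (𝓡 n) (𝓡 k) α (φ 0 y)) := by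
    rw [hφ0]; exact hα.hasMFDerivAt
  have hτX : mfderiv (𝓡 n) 𝓘(ℝ, ℝ) τ y (X y) = (1 : ℝ) := by
    have h1 : HasMFDerivAt 𝓘(ℝ, ℝ) 𝓘(ℝ, ℝ) (fun t : ℝ => τ y + t) 0
        (ContinuousLinearMap.id ℝ ℝ) := ((hasFDerivAt_id _).const_add _).hasMFDerivAt
    have h2 := hasMFDerivAt_unique ((hτ'.comp (0 : ℝ) h0).congr_of_eventuallyEq
      (hφ.mono fun t ht => ht.1.symm)) h1
    have h3 : mfderiv (𝓡 n) 𝓘(ℝ, ℝ) τ (φ 0 y) ((1 : ℝ) • X (φ 0 y)) = (1 : ℝ) :=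
      DFunLike.congr_fun h2 (1 : ℝ)
    have key : ∀ z, z = y → mfderiv (𝓡 n) 𝓘(ℝ, ℝ) τ z ((1 : ℝ) • X z) = (1 : ℝ) →
        mfderiv (𝓡 n) 𝓘(ℝ, ℝ) τ y (X y) = (1 : ℝ) := by
      rintro _ rfl hz
      rwa [one_smul] at hz
    exact key _ hφ0 h3
  have hαX : mfderiv (𝓡 n) (𝓡 k) α y (X y) = 0 := by
    have h1 : HasMFDerivAt 𝓘(ℝ, ℝ) (𝓡 k) (fun _ : ℝ => α y) 0 0 := hasMFDerivAt_const _ _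
    have h2 := hasMFDerivAt_unique ((hα''.comp (0 : ℝ) h0).congr_of_eventuallyEq
      (hφ.mono fun t ht => ht.2.symm)) h1
    have h3 : mfderiv (𝓡 n) (𝓡 k) α (φ 0 y) ((1 : ℝ) • X (φ 0 y)) = 0 :=
      DFunLike.congr_fun h2 (1 : ℝ)
    have key : ∀ z, z = y → mfderiv (𝓡 n) (𝓡 k) α z ((1 : ℝ) • X z) = 0 →
        mfderiv (𝓡 n) (𝓡 k) α y (X y) = 0 := by
      rintro _ rfl hz
      rwa [one_smul] at hz
    exact key _ hφ0 h3
  -- Write `v = d + s • X y` with `d` tangent to `F`. As `dα` kills `X`, it forces `d = 0`; then `dτ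
  -- X = 1` forces `s = 0`.
  obtain ⟨d, hd, w, hw, rfl⟩ := Submodule.mem_sup.1 hv
  obtain ⟨s, rfl⟩ := Submodule.mem_span_singleton.1 hw
  have hd0 : d = 0 := by
    refine hα' d hd ?_
    rw [map_add, map_smul, hαX] at hαv
    simpa using hαv
  subst hd0
  have hs : s = 0 := by
    rw [zero_add, map_smul, hτX] at hτv
    exact (mul_one s).symm.trans hτv
  simp [hs]

end SaturatedChart

/-! ### The transverse coordinate invariant under the flow -/

section SaturatedChart

open Filter Topology Set Metric

variable {r : ℕ∞} {k n : ℕ} {M : Type u} [TopologicalSpace M]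
  [ChartedSpace (EuclideanSpace ℝ (Fin n)) M] {F : Foliation r k n M} {φ : Flow ℝ M}
  {X : ∀ x : M, TangentSpace (𝓡 n) x}

/-- A chart whose slices are contained in the saturations of the leaves of `F` under the flow, in
the form needed to construct foliated charts. -/
theorem Foliation.IsTransverseFlow.exists_saturated_chart [IsManifold (𝓡 n) ∞ M]
    (h : F.IsTransverseFlow φ X) (hr : 1 ≤ r) (hF : F.IsIntegral) (x₀ : M) :
    ∃ Ψ : OpenPartialHomeomorph M
        (EuclideanSpace ℝ (Fin (k + 1)) × EuclideanSpace ℝ (Fin (n - (k + 1)))),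
      ∃ δ > 0, x₀ ∈ Ψ.source ∧ Ψ.target = ball 0 δ ×ˢ ball 0 δ ∧
      (∀ y ∈ Ψ.source, ContMDiffAt (𝓡 n) (𝓡 (k + 1)) r (fun y => (Ψ y).1) y) ∧
      (∀ y ∈ Ψ.source, ∀ v ∈ F.tangentSpace y ⊔ Submodule.span ℝ {X y},
        mfderiv (𝓡 n) (𝓡 (k + 1)) (fun y => (Ψ y).1) y v = 0 → v = 0) ∧
      (∀ b (q : (F.leaf b).Pt), (F.leaf b).incl q ∈ Ψ.source →
        ∀ᶠ z : ℝ × (F.leaf b).Pt in 𝓝 (0, q),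
          (Ψ (φ z.1 ((F.leaf b).incl z.2))).2 = (Ψ ((F.leaf b).incl q)).2) ∧
      ∀ c ∈ ball (0 : EuclideanSpace ℝ (Fin (n - (k + 1)))) δ,
        ∃ (b : F.ι) (T : ball (0 : EuclideanSpace ℝ (Fin (k + 1))) δ → ℝ)
          (g : ball (0 : EuclideanSpace ℝ (Fin (k + 1))) δ → (F.leaf b).Pt),
          Continuous T ∧ Continuous g ∧
            ∀ u, φ (T u) ((F.leaf b).incl (g u)) = Ψ.symm (u, c) := by
  have hr0 : (r : WithTop ℕ∞) ≠ 0 := by simpa using (zero_lt_one.trans_le hr).ne'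
  obtain ⟨b⟩ := h.nonempty_flowBox hr hF x₀
  obtain ⟨ψ, U₁, U₂, hx₀, hψ⟩ := F.exists_chart x₀
  have hφ0 : φ 0 x₀ = x₀ := φ.map_zero_apply x₀
  have hφt : Tendsto (fun z : ℝ × M => φ z.1 z.2) (𝓝 (0, x₀)) (𝓝 x₀) := by
    have := (φ.continuous continuous_fst continuous_snd).tendsto ((0 : ℝ), x₀)
    rwa [hφ0] at this
  obtain ⟨A, hA, N, hN, hAN⟩ := mem_nhds_prod_iff.1
    (hφt.eventually (ψ.open_source.mem_nhds hx₀))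
  obtain ⟨Γ, δ₀, hδ₀, V, hxΓ, hΓG, hΓt, hΓ⟩ := hψ.exists_openPartialHomeomorph hr hx₀
    b.contMDiffAt_α b.mfderiv_α
    (inter_mem hN (b.contMDiffAt_τ.and (b.contMDiffAt_α.and b.mfderiv_α)))
  rw [b.α_base] at hΓt
  have hΓψ : Γ.source ⊆ ψ.source := fun y hy => (hΓG hy).2
  have htr : ∀ t ∈ A, ∀ y ∈ Γ.source, ∀ y' ∈ Γ.source, (ψ y).2 = (ψ y').2 →
      (ψ (φ t y)).2 = (ψ (φ t y')).2 := fun t ht y hy y' hy' =>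
    h.snd_apply_eq hψ (convex_ball 0 δ₀).isPreconnected hΓψ hΓt hΓ
      (fun z hz => hAN (show (t, z) ∈ A ×ˢ N from ⟨ht, (hΓG hz).1.1⟩)) hy hy'
  have hΓτ : ∀ y ∈ Γ.source, ContMDiffAt (𝓡 n) 𝓘(ℝ, ℝ) r b.τ y := fun y hy => (hΓG hy).1.2.1
  have hΓα : ∀ y ∈ Γ.source, ContMDiffAt (𝓡 n) (𝓡 k) r b.α y := fun y hy => (hΓG hy).1.2.2.1
  have hmem : ∀ y ∈ Γ.source, b.α y ∈ ball 0 δ₀ ∧ (ψ y).2 ∈ V := fun y hy => by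
    have := Γ.map_source hy
    rwa [hΓt, hΓ y hy] at this
  have hΓsymm : ∀ z ∈ Γ.target, b.α (Γ.symm z) = z.1 ∧ (ψ (Γ.symm z)).2 = z.2 := fun z hz => by
    have := Γ.right_inv hz
    rw [hΓ _ (Γ.map_target hz)] at this
    exact Prod.ext_iff.1 this
  have hsymmΓ : ∀ y ∈ Γ.source, Γ.symm (b.α y, (ψ y).2) = y := fun y hy => by
    rw [← hΓ y hy, Γ.left_inv hy]
  have hΓev : ∀ᶠ y in 𝓝 x₀, y ∈ Γ.source := Γ.open_source.mem_nhds hxΓ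
  -- `π` slides a point along its plaque to the transversal `α = 0`.
  set π : M → M := fun y => Γ.symm (0, (ψ y).2)
  have hπt : ∀ y ∈ Γ.source, ((0 : EuclideanSpace ℝ (Fin k)), (ψ y).2) ∈ Γ.target := fun y hy => by
    rw [hΓt]
    exact ⟨mem_ball_self hδ₀, (hmem y hy).2⟩
  have hπs : ∀ y ∈ Γ.source, π y ∈ Γ.source := fun y hy => Γ.map_target (hπt y hy)
  have hπα : ∀ y ∈ Γ.source, b.α (π y) = 0 := fun y hy => (hΓsymm _ (hπt y hy)).1
  have hπψ : ∀ y ∈ Γ.source, (ψ (π y)).2 = (ψ y).2 := fun y hy => (hΓsymm _ (hπt y hy)).2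
  have hπ_eq : ∀ y ∈ Γ.source, b.α y = 0 → π y = y := fun y hy hy0 => by
    have := hsymmΓ y hy
    rwa [hy0] at this
  have hπ0 : π x₀ = x₀ := hπ_eq x₀ hxΓ b.α_base
  have hπc : ∀ y ∈ Γ.source, ContinuousAt π y := fun y hy =>
    ContinuousAt.comp (g := Γ.symm) (Γ.continuousAt_symm (hπt y hy))
      (continuousAt_const.prodMk (continuous_snd.continuousAt.comp (ψ.continuousAt (hΓψ hy))))
  have hπx : Tendsto π (𝓝 x₀) (𝓝 x₀) := by
    have := hπc x₀ hxΓ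
    rwa [ContinuousAt, hπ0] at this
  have hsndx : Tendsto (fun z : ℝ × M => z.2) (𝓝 (0, x₀)) (𝓝 x₀) := continuous_snd.tendsto _
  have hfstx : Tendsto (fun z : ℝ × M => z.1) (𝓝 (0, x₀)) (𝓝 0) := continuous_fst.tendsto _
  have hpair : Tendsto (fun z : ℝ × M => (z.1, π z.2)) (𝓝 (0, x₀)) (𝓝 (0, x₀)) :=
    hfstx.prodMk_nhds (hπx.comp hsndx)
  -- The flow maps plaques to plaques and preserves `α`, so it takes the point of a plaque with `α =
  -- 0` to the point of the image plaque with `α = 0`.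
  have hπφ : ∀ᶠ z : ℝ × M in 𝓝 (0, x₀), π (φ z.1 z.2) = φ z.1 (π z.2) := by
    filter_upwards [hfstx.eventually hA, hsndx.eventually hΓev, hφt.eventually hΓev,
      (hφt.comp hpair).eventually hΓev, hpair.eventually b.flow] with z hzA hz hz1 hz2 hz3
    have h1 : (ψ (φ z.1 z.2)).2 = (ψ (φ z.1 (π z.2))).2 :=
      htr _ hzA _ hz _ (hπs _ hz) (hπψ _ hz).symm
    have h2 : π (φ z.1 z.2) = π (φ z.1 (π z.2)) := by simp only [π] at h1 ⊢; rw [h1]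
    rw [h2]
    exact hπ_eq _ hz2 (hz3.2.1.trans (hπα _ hz))
  -- By itself `β` is invariant under the flow only; composed with `π`, which depends only on the
  -- plaque, it is also constant along plaques.
  have hρφ : ∀ᶠ z : ℝ × M in 𝓝 (0, x₀), b.β (π (φ z.1 z.2)) = b.β (π z.2) := by
    filter_upwards [hπφ, hpair.eventually b.flow] with z hz hz'
    rw [hz]
    exact hz'.2.2
  let ε : EuclideanSpace ℝ (Fin (k + 1)) ≃L[ℝ] (ℝ × EuclideanSpace ℝ (Fin k)) :=
    ContinuousLinearEquiv.ofFinrankEq (by simp [add_comm])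
  set f : M → EuclideanSpace ℝ (Fin (k + 1)) × EuclideanSpace ℝ (Fin (n - (k + 1))) :=
    fun y => (ε.symm (b.τ y, b.α y), b.β (π y)) with hf
  -- The inverse of `f`: from `σ w.2`, where `τ = α = 0`, `P` moves along the plaque to the
  -- prescribed `α`, and `g` flows until `τ` has the prescribed value.
  set P : EuclideanSpace ℝ (Fin (k + 1)) × EuclideanSpace ℝ (Fin (n - (k + 1))) → M :=
    fun w => Γ.symm ((ε w.1).2, (ψ (b.σ w.2)).2) with hP
  set g : EuclideanSpace ℝ (Fin (k + 1)) × EuclideanSpace ℝ (Fin (n - (k + 1))) → M :=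
    fun w => φ ((ε w.1).1 - b.τ (P w)) (P w) with hg
  have hfx : f x₀ = 0 := by
    simp only [f, hπ0, b.τ_base, b.α_base, b.β_base, Prod.mk_zero_zero, map_zero]
  have hσt : Tendsto b.σ (𝓝 0) (𝓝 x₀) := by
    have := b.continuousAt_σ.self_of_nhds
    rwa [ContinuousAt, b.σ_zero] at this
  have hw2 : Tendsto (fun w : EuclideanSpace ℝ (Fin (k + 1)) ×
      EuclideanSpace ℝ (Fin (n - (k + 1))) => w.2) (𝓝 0) (𝓝 0) := continuous_snd.tendsto _
  have hw1 : Tendsto (fun w : EuclideanSpace ℝ (Fin (k + 1)) ×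
      EuclideanSpace ℝ (Fin (n - (k + 1))) => ε w.1) (𝓝 0) (𝓝 0) := by
    have h1 : Continuous fun w : EuclideanSpace ℝ (Fin (k + 1)) ×
      EuclideanSpace ℝ (Fin (n - (k + 1))) => ε w.1 := by fun_prop
    have := h1.tendsto 0
    rwa [Prod.fst_zero, map_zero] at this
  have hPtgt : ∀ᶠ w : EuclideanSpace ℝ (Fin (k + 1)) × EuclideanSpace ℝ (Fin (n - (k + 1))) in
      𝓝 0, b.σ w.2 ∈ Γ.source ∧ ((ε w.1).2, (ψ (b.σ w.2)).2) ∈ Γ.target := by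
    have h1 : Tendsto (fun w : EuclideanSpace ℝ (Fin (k + 1)) ×
        EuclideanSpace ℝ (Fin (n - (k + 1))) => (ε w.1).2) (𝓝 0) (𝓝 0) :=
      (continuous_snd.tendsto _).comp hw1
    filter_upwards [(hσt.comp hw2).eventually hΓev, h1.eventually (ball_mem_nhds _ hδ₀)]
      with w hw hw'
    refine ⟨hw, ?_⟩
    rw [hΓt]
    exact ⟨hw', (hmem _ hw).2⟩
  have hPc : ∀ᶠ w in 𝓝 0, ContinuousAt P w := by
    filter_upwards [hPtgt, hw2.eventually b.continuousAt_σ] with w hw hw'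
    refine ContinuousAt.comp (g := Γ.symm) (Γ.continuousAt_symm hw.2) (ContinuousAt.prodMk ?_ ?_)
    · exact (by fun_prop : Continuous fun w : EuclideanSpace ℝ (Fin (k + 1)) ×
        EuclideanSpace ℝ (Fin (n - (k + 1))) => (ε w.1).2).continuousAt
    · exact continuous_snd.continuousAt.comp (ContinuousAt.comp (g := ψ)
        (ψ.continuousAt (hΓψ hw.1)) (ContinuousAt.comp (g := b.σ) hw' continuous_snd.continuousAt))
  have hP0 : P 0 = x₀ := by
    have := hsymmΓ x₀ hxΓ
    rw [b.α_base] at this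
    simpa [P, b.σ_zero] using this
  have hPx : Tendsto P (𝓝 0) (𝓝 x₀) := by
    have := hPc.self_of_nhds
    rwa [ContinuousAt, hP0] at this
  have hfc : ∀ᶠ y in 𝓝 x₀, ContinuousAt f y := by
    filter_upwards [hΓev, hπx.eventually b.continuousAt_β] with y hy hy'
    exact ContinuousAt.prodMk (ε.symm.continuous.continuousAt.comp
      ((hΓτ y hy).continuousAt.prodMk (hΓα y hy).continuousAt))
      (ContinuousAt.comp (g := b.β) hy' (hπc y hy))
  have hgc : ∀ᶠ w in 𝓝 0, ContinuousAt g w := by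
    filter_upwards [hPc, hPtgt] with w hw hw'
    have h1 : ContinuousAt (fun w => b.τ (P w)) w :=
      ContinuousAt.comp (g := b.τ) (hΓτ _ (Γ.map_target hw'.2)).continuousAt hw
    have h2 : ContinuousAt (fun w : EuclideanSpace ℝ (Fin (k + 1)) ×
        EuclideanSpace ℝ (Fin (n - (k + 1))) => (ε w.1).1) w :=
      (by fun_prop : Continuous fun w : EuclideanSpace ℝ (Fin (k + 1)) ×
        EuclideanSpace ℝ (Fin (n - (k + 1))) => (ε w.1).1).continuousAt
    exact (φ.continuous continuous_fst continuous_snd).continuousAt.comp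
      ((h2.sub h1).prodMk hw)
  have hτx : Tendsto b.τ (𝓝 x₀) (𝓝 0) := by
    have := (hΓτ x₀ hxΓ).continuousAt
    rwa [ContinuousAt, b.τ_base] at this
  have hgf : ∀ᶠ y in 𝓝 x₀, g (f y) = y := by
    have ht : Tendsto (fun y => -b.τ (π y)) (𝓝 x₀) (𝓝 0) := by
      simpa using (hτx.comp hπx).neg
    have ht1 : Tendsto (fun y => (-b.τ (π y), y)) (𝓝 x₀) (𝓝 (0, x₀)) := ht.prodMk_nhds tendsto_id
    have ht2 : Tendsto (fun y => (-b.τ (π y), π y)) (𝓝 x₀) (𝓝 (0, x₀)) := ht.prodMk_nhds hπx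
    filter_upwards [hΓev, ht.eventually hA, ht1.eventually b.flow, ht2.eventually b.flow,
      (hφt.comp ht1).eventually hΓev, (hφt.comp ht2).eventually b.σ_β]
      with y hy hyA hy1 hy2 hy3 hy4
    -- Flowing for time `t` brings `π y` to `τ = 0`, that is to `σ (β (π y))`, and brings `y` to the
    -- point of the same plaque with its own `α`. Hence `P (f y) = φ t y`, and `g` flows back by
    -- `-t`.
    set t := -b.τ (π y)
    have h1 : b.σ (b.β (π y)) = φ t (π y) := by
      rw [← hy2.2.2]
      exact hy4 (hy2.1.trans (by simp [t])) (hy2.2.1.trans (hπα y hy))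
    have h2 : (ψ (φ t (π y))).2 = (ψ (φ t y)).2 := htr t hyA _ (hπs y hy) _ hy (hπψ y hy)
    have h3 : P (f y) = φ t y := by
      simp only [P, f, ε.apply_symm_apply, h1, h2]
      rw [← hy1.2.1]
      exact hsymmΓ _ hy3
    have h4 : (ε (f y).1).1 - b.τ (P (f y)) = -t := by
      rw [h3, hy1.1]
      simp [f]
    change φ ((ε (f y).1).1 - b.τ (P (f y))) (P (f y)) = y
    rw [h4, h3, φ.apply_neg_apply]
  have hfg : ∀ᶠ w in 𝓝 0, f (g w) = w := by
    have ht : Tendsto (fun w => ((ε w.1).1 - b.τ (P w), P w)) (𝓝 0) (𝓝 (0, x₀)) := by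
      refine Tendsto.prodMk_nhds ?_ hPx
      simpa using ((continuous_fst.tendsto _).comp hw1).sub (hτx.comp hPx)
    filter_upwards [hPtgt, ht.eventually b.flow, ht.eventually hρφ, hw2.eventually b.coord_σ]
      with w hw hw1 hw2 hw3
    have h1 : π (P w) = b.σ w.2 := by
      have h2 : (ψ (P w)).2 = (ψ (b.σ w.2)).2 := (hΓsymm _ hw.2).2
      have h3 : π (P w) = π (b.σ w.2) := by simp only [π] at h2 ⊢; rw [h2]
      rw [h3]
      exact hπ_eq _ hw.1 hw3.2.1
    have h4 : b.τ (g w) = (ε w.1).1 := hw1.1.trans (by ring)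
    have h5 : b.α (g w) = (ε w.1).2 := hw1.2.1.trans (hΓsymm _ hw.2).1
    have h6 : b.β (π (g w)) = w.2 := by
      refine hw2.trans ?_
      rw [h1]
      exact hw3.2.2
    refine Prod.ext ?_ h6
    simp only [f, h4, h5, Prod.mk.eta, ε.symm_apply_apply]
  obtain ⟨e, hxe, he, hes⟩ := exists_openPartialHomeomorph_of_eventually_inverse hfc
    (by rwa [hfx]) hgf (by rwa [hfx])
  have h0y : Tendsto (fun y => ((0 : ℝ), y)) (𝓝 x₀) (𝓝 (0, x₀)) :=
    tendsto_const_nhds.prodMk_nhds tendsto_id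
  have hgood : ∀ᶠ y in 𝓝 x₀, y ∈ Γ.source ∧
      (∀ᶠ t : ℝ in 𝓝 0, b.τ (φ t y) = b.τ y + t ∧ b.α (φ t y) = b.α y) ∧
      ∀ᶠ z : ℝ × M in 𝓝 (0, y), b.β (π (φ z.1 z.2)) = b.β (π z.2) := by
    filter_upwards [hΓev, h0y.eventually b.flow.eventually_nhds,
      h0y.eventually hρφ.eventually_nhds] with y hy hy1 hy2
    refine ⟨hy, ?_, hy2⟩
    have ht : Tendsto (fun t : ℝ => (t, y)) (𝓝 0) (𝓝 (0, y)) :=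
      tendsto_id.prodMk_nhds tendsto_const_nhds
    exact (ht.eventually hy1).mono fun t ht => ⟨ht.1, ht.2.1⟩
  have hex : e x₀ = 0 := (he x₀).trans hfx
  have h0t : (0 : EuclideanSpace ℝ (Fin (k + 1)) × EuclideanSpace ℝ (Fin (n - (k + 1)))) ∈
      e.target := hex ▸ e.map_source hxe
  have hex' : e.symm 0 = x₀ := by rw [← hex, e.left_inv hxe]
  have hest : Tendsto e.symm (𝓝 0) (𝓝 x₀) := by
    have := e.continuousAt_symm h0t
    rwa [ContinuousAt, hex'] at this
  obtain ⟨δ, hδ, hδT⟩ := Metric.mem_nhds_iff.1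
    (inter_mem (e.open_target.mem_nhds h0t) ((hest.eventually hgood).and hPtgt))
  obtain ⟨Ψ, hΨs, hΨt, hΨ, hΨsymm⟩ := e.exists_target_eq isOpen_ball (hδT.trans inter_subset_left)
  have hΨf : ∀ y, Ψ y = f y := fun y => (hΨ y).trans (he y)
  have hΨg : ∀ w, Ψ.symm w = g w := fun w => (hΨsymm w).trans (hes w)
  have hΨgood : ∀ y ∈ Ψ.source, y ∈ Γ.source ∧
      (∀ᶠ t : ℝ in 𝓝 0, b.τ (φ t y) = b.τ y + t ∧ b.α (φ t y) = b.α y) ∧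
      ∀ᶠ z : ℝ × M in 𝓝 (0, y), b.β (π (φ z.1 z.2)) = b.β (π z.2) := fun y hy => by
    have h1 := Ψ.map_source hy
    rw [hΨt] at h1
    have h2 := (hδT h1).2.1
    rwa [← hΨsymm, Ψ.left_inv hy] at h2
  have hΨ1 : (fun y => (Ψ y).1) = fun y => ε.symm (b.τ y, b.α y) := funext fun y => by rw [hΨf]
  refine ⟨Ψ, δ, hδ, ?_, ?_, fun y hy => ?_, fun y hy v hv hv0 => ?_, fun a q hq => ?_,
    fun c hc => ?_⟩
  · rw [hΨs]
    exact ⟨hxe, by rw [mem_preimage, hex]; exact mem_ball_self hδ⟩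
  · rw [hΨt, ball_prod_same]
    rfl
  · rw [hΨ1]
    exact ε.symm.contDiff.contMDiff.contMDiffAt.comp y
      ((hΓτ y (hΨgood y hy).1).prodMk_space (hΓα y (hΨgood y hy).1))
  · rw [hΨ1] at hv0
    obtain ⟨hy1, hy2, -⟩ := hΨgood y hy
    exact h.eq_zero_of_mfderiv_eq_zero ε ((hΓτ y hy1).mdifferentiableAt hr0)
      ((hΓα y hy1).mdifferentiableAt hr0) (hΓG hy1).1.2.2.2 hy2 hv hv0
  · obtain ⟨hy1, -, hy3⟩ := hΨgood _ hq
    have hqψ := hΓψ hy1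
    have ht : Tendsto (fun z : ℝ × (F.leaf a).Pt => (z.1, (F.leaf a).incl z.2)) (𝓝 (0, q))
        (𝓝 (0, (F.leaf a).incl q)) :=
      (continuous_fst.tendsto _).prodMk_nhds
        (((F.leaf a).continuous_incl.comp continuous_snd).tendsto _)
    have hpl : ∀ᶠ z : ℝ × (F.leaf a).Pt in 𝓝 (0, q),
        z.2 ∈ connectedComponentIn ((F.leaf a).incl ⁻¹' ψ.source) q :=
      continuous_snd.continuousAt.eventually
        (((F.leaf a).isOpen_connectedComponentIn ψ.open_source q).mem_nhds
          (mem_connectedComponentIn hqψ))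
    filter_upwards [ht.eventually hy3, hpl] with z hz hz'
    rw [hΨf, hΨf]
    refine hz.trans ?_
    simp only [π, f]
    rw [hψ.snd_eq_of_mem_plaque hqψ hz']
  · have hball : ∀ u : ball (0 : EuclideanSpace ℝ (Fin (k + 1))) δ,
        b.σ c ∈ Γ.source ∧ ((ε u).2, (ψ (b.σ c)).2) ∈ Γ.target := fun u => by
      have h1 : ((u : EuclideanSpace ℝ (Fin (k + 1))), c) ∈
          ball (0 : EuclideanSpace ℝ (Fin (k + 1)) × EuclideanSpace ℝ (Fin (n - (k + 1)))) δ := by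
        rw [← Prod.mk_zero_zero, ← ball_prod_same]
        exact ⟨u.2, hc⟩
      exact (hδT h1).2.2
    -- For fixed `c` all points `P (u, c)` lie in the plaque of `σ c`, so the whole slice is
    -- obtained by flowing points of one leaf.
    obtain ⟨a, ha⟩ := hψ.exists_incl_eq (hΓψ (hball ⟨0, mem_ball_self hδ⟩).1)
    have hPs : ∀ u : ball (0 : EuclideanSpace ℝ (Fin (k + 1))) δ, P (u, c) ∈ Γ.source :=
      fun u => Γ.map_target (hball u).2
    choose q hq using fun u : ball (0 : EuclideanSpace ℝ (Fin (k + 1))) δ =>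
      ha (P (u, c)) (hΓψ (hPs u)) (hΓsymm _ (hball u).2).2
    have hPc' : Continuous fun u : ball (0 : EuclideanSpace ℝ (Fin (k + 1))) δ => P (u, c) :=
      Γ.symm.continuousOn.comp_continuous
        ((continuous_snd.comp (ε.continuous.comp continuous_subtype_val)).prodMk
          (continuous_const (y := (ψ (b.σ c)).2)))
        fun u => (hball u).2
    refine ⟨a, fun u => (ε u).1 - b.τ (P (u, c)), q, ?_, ?_, fun u => ?_⟩
    · refine (continuous_fst.comp (ε.continuous.comp continuous_subtype_val)).sub
         (continuous_iff_continuousAt.2 fun u => ?_)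
      exact ContinuousAt.comp (g := b.τ) (hΓτ _ (hPs u)).continuousAt hPc'.continuousAt
    · have := (isOpen_ball (x := (0 : EuclideanSpace ℝ (Fin (k + 1)))) (ε := δ)).locallyConnectedSpace
      exact F.continuous_of_continuous_incl (by simpa only [hq] using hPc')
    · rw [hq, hΨg]

end SaturatedChart

/-! ### The saturated foliation -/

section Saturation

open Filter Topology Set Metric

variable {r : ℕ∞} {k n : ℕ} {M : Type u} [TopologicalSpace M]
  [ChartedSpace (EuclideanSpace ℝ (Fin n)) M] {F : Foliation r k n M}
  {φ : Flow ℝ M} {X : ∀ x : M, TangentSpace (𝓡 n) x}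

namespace Foliation.IsTransverseFlow

theorem iUnion_image_leafThrough_eq (h : F.IsTransverseFlow φ X) {x y : M}
    (hy : y ∈ ⋃ t : ℝ, φ t '' F.leafThrough x) :
    ⋃ t : ℝ, φ t '' F.leafThrough y = ⋃ t : ℝ, φ t '' F.leafThrough x := by
  obtain ⟨s, hs⟩ := mem_iUnion.1 hy
  rw [h.image_leafThrough] at hs
  simp only [F.leafThrough_eq_of_mem hs, ← h.image_leafThrough, ← image_comp]
  have key : ∀ t, φ t ∘ φ s = φ (t + s) := fun t => funext fun z => (φ.map_add t s z).symm
  simp only [key]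
  exact (Equiv.addRight s).surjective.iUnion_comp fun t => φ t '' F.leafThrough x

variable [T2Space M] [IsManifold (𝓡 n) ∞ M]

/-- The saturations of the leaves under the flow have foliated charts. -/
theorem exists_isFoliatedChart_saturation (h : F.IsTransverseFlow φ X) (hr : 1 ≤ r)
    (hF : F.IsIntegral) {ι : Type u} (a : ι → F.ι) (x₀ : M) :
    ∃ ψ U₁ U₂, x₀ ∈ ψ.source ∧ IsFoliatedChart (fun i => h.saturation hr (a i)) ψ U₁ U₂ := by
  obtain ⟨Ψ, δ, hδ, hx₀, hΨt, hΨs, hΨi, hΨloc, hΨlift⟩ := h.exists_saturated_chart hr hF x₀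
  refine ⟨Ψ, ball 0 δ, ball 0 δ, hx₀, .of_exists_lift hr isOpen_ball isOpen_ball
    (isConnected_ball hδ) (isConnected_ball hδ) hΨt (fun i w hw => ?_) (fun i w hw => ?_) hΨs
    fun i w hw v hv => hΨi _ hw v ?_⟩
  · obtain ⟨⟨t, p⟩, rfl⟩ := Quotient.exists_rep (s := Setoid.ker (F.flowMap φ (a i))) w
    have hx : φ t ((F.leaf (a i)).incl p) = (F.leaf _).incl (F.leafPoint _) :=
      (F.incl_leafPoint (φ t ((F.leaf (a i)).incl p))).symm
    obtain ⟨g, hg, hgi⟩ := h.exists_continuous_lift hx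
    have hgp : (F.leaf _).incl (g p) ∈ Ψ.source := by rw [hgi]; exact hw
    -- The lift `g` of `φ t` and the time shift by `t` move `(t, p)` to time `0` on the leaf of `F`
    -- through the point itself, where `hΨloc` applies; openness of the quotient map transfers the
    -- result to the saturation.
    have h1 : Tendsto (fun z : ℝ × (F.leaf (a i)).Pt => (z.1 - t, g z.2)) (𝓝 (t, p))
        (𝓝 (0, g p)) := by
      have h2 : Continuous fun z : ℝ × (F.leaf (a i)).Pt => (z.1 - t, g z.2) := by fun_prop
      simpa using h2.tendsto (t, p)
    refine ((h.isOpenMap_saturation_mk (a i)).nhds_le (t, p)) ?_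
    refine (h1.eventually (hΨloc _ _ hgp)).mono fun z hz => ?_
    rw [hgi, hgi, ← φ.map_add, sub_add_cancel] at hz
    exact hz
  · have hc := Ψ.map_source hw
    rw [hΨt] at hc
    obtain ⟨b, T, g, hT, hg, hgT⟩ := hΨlift _ hc.2
    have hw' := (hgT ⟨_, hc.1⟩).trans (Ψ.left_inv hw)
    generalize (⟨_, hc.1⟩ : ball (0 : EuclideanSpace ℝ (Fin (k + 1))) δ) = u₀ at hw'
    obtain ⟨⟨t, p⟩, htp⟩ := Quotient.exists_rep (s := Setoid.ker (F.flowMap φ (a i))) w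
    have hx : φ t ((F.leaf (a i)).incl p) = (h.saturation hr (a i)).incl w :=
      congrArg (h.saturation hr (a i)).incl htp
    have hpq : φ (-T u₀ + t) ((F.leaf (a i)).incl p) = (F.leaf b).incl (g u₀) := by
      rw [φ.map_add, hx, ← hw', φ.apply_neg_apply]
    obtain ⟨H, hH, hHi⟩ := h.exists_continuous_saturation_incl hr hpq hT hg
    classical
    -- The value `w` outside the ball is arbitrary: only the values on the ball matter.
    refine ⟨fun u => if hu : u ∈ ball 0 δ then H ⟨u, hu⟩ else w, ?_, fun u hu => ?_⟩
    · refine continuousOn_iff_continuous_domRestrict.2 (hH.congr fun u => ?_)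
      simp [Set.domRestrict, u.2]
    · simp only [dif_pos hu, hHi, hgT]
  · rwa [h.range_mfderiv_saturation_incl] at hv

/-- The foliation whose leaves are the saturations of the leaves of `F` under the flow. -/
noncomputable def saturatedFoliation (h : F.IsTransverseFlow φ X) (hr : 1 ≤ r)
    (hF : F.IsIntegral) : Foliation r (k + 1) n M where
  -- The index is the saturated set itself, since distinct leaves of `F` can have the same
  -- saturation.
  ι := {S : Set M // ∃ x, S = ⋃ t : ℝ, φ t '' F.leafThrough x}
  leaf S := h.saturation hr (F.leafIndex S.2.choose)
  connectedSpace_leaf S := connectedSpace_saturation _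
  existsUnique_leaf x := by
    have key : ∀ S : {S : Set M // ∃ x, S = ⋃ t : ℝ, φ t '' F.leafThrough x},
        range (h.saturation hr (F.leafIndex S.2.choose)).incl = S := fun S =>
      (h.range_saturation_incl hr _).trans S.2.choose_spec.symm
    simp only [key]
    refine ⟨⟨_, x, rfl⟩, mem_iUnion.2 ⟨0, x, F.mem_leafThrough x, φ.map_zero_apply x⟩, ?_⟩
    rintro ⟨_, y, rfl⟩ hx
    exact Subtype.ext (h.iUnion_image_leafThrough_eq hx).symm
  exists_chart x := h.exists_isFoliatedChart_saturation hr hF _ x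

theorem leafThrough_saturatedFoliation (h : F.IsTransverseFlow φ X) (hr : 1 ≤ r)
    (hF : F.IsIntegral) (x : M) :
    (h.saturatedFoliation hr hF).leafThrough x = ⋃ t : ℝ, φ t '' F.leafThrough x := by
  have h1 := (h.saturatedFoliation hr hF).mem_leafThrough x
  have h2 : (h.saturatedFoliation hr hF).leafThrough x = ⋃ t : ℝ, φ t '' F.leafThrough _ :=
    h.range_saturation_incl hr _
  rw [h2] at h1 ⊢
  exact (h.iUnion_image_leafThrough_eq h1).symm

theorem tangentSpace_saturatedFoliation (h : F.IsTransverseFlow φ X) (hr : 1 ≤ r)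
    (hF : F.IsIntegral) (x : M) :
    (h.saturatedFoliation hr hF).tangentSpace x =
      F.tangentSpace x ⊔ Submodule.span ℝ {X x} := by
  have key : ∀ S (w : ((h.saturatedFoliation hr hF).leaf S).Pt),
      (h.saturatedFoliation hr hF).tangentSpace (((h.saturatedFoliation hr hF).leaf S).incl w) =
        F.tangentSpace (((h.saturatedFoliation hr hF).leaf S).incl w) ⊔
          Submodule.span ℝ {X (((h.saturatedFoliation hr hF).leaf S).incl w)} := fun S w =>
    ((h.saturatedFoliation hr hF).tangentSpace_incl S w).trans
      (h.range_mfderiv_saturation_incl hr _ w)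
  have := key _ ((h.saturatedFoliation hr hF).leafPoint x)
  rwa [(h.saturatedFoliation hr hF).incl_leafPoint] at this

theorem isIntegral_saturatedFoliation (h : F.IsTransverseFlow φ X) (hr : 1 ≤ r)
    (hF : F.IsIntegral) : (h.saturatedFoliation hr hF).IsIntegral := by
  have h1 : (h.saturatedFoliation hr hF).tangentSpace =
      fun x => F.tangentSpace x ⊔ Submodule.span ℝ {X x} :=
    funext fun x => h.tangentSpace_saturatedFoliation hr hF x
  rw [IsIntegral, h1]
  exact h.isContinuousSubbundle_sup_span hF

end Foliation.IsTransverseFlow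

end Saturation

theorem mainTheorem5 {n k : ℕ} {r : ℕ∞} (hr : 1 ≤ r)
    {M : Type u} [TopologicalSpace M] [T2Space M] [SecondCountableTopology M]
    [ChartedSpace (EuclideanSpace ℝ (Fin n)) M] [IsManifold (𝓡 n) ∞ M]
    (φ : Flow ℝ M)
    (hφ : ContMDiff (𝓘(ℝ, ℝ).prod (𝓡 n)) (𝓡 n) ∞ (fun p : ℝ × M => φ p.1 p.2))
    (X : ∀ x : M, TangentSpace (𝓡 n) x)
    (hX : ∀ x : M, IsMIntegralCurve (I := 𝓡 n) (fun t : ℝ => φ t x) X)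
    (hX0 : ∀ x : M, X x ≠ 0)
    (F : Foliation r k n M) (hF : F.IsIntegral)
    (hinv : ∀ (t : ℝ) (x : M), φ t '' F.leafThrough x = F.leafThrough (φ t x))
    (htrans : ∀ x : M, X x ∉ F.tangentSpace x) :
    ∃ Fw : Foliation r (k + 1) n M,
      Fw.IsIntegral ∧
      (∀ x : M, Fw.leafThrough x = ⋃ t : ℝ, φ t '' F.leafThrough x) ∧
      (∀ x : M, Disjoint (F.tangentSpace x) (Submodule.span ℝ {X x}) ∧
        Fw.tangentSpace x = F.tangentSpace x ⊔ Submodule.span ℝ {X x}) := by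
  have h : F.IsTransverseFlow φ X := ⟨hφ, hX, hinv, htrans⟩
  exact ⟨h.saturatedFoliation hr hF, h.isIntegral_saturatedFoliation hr hF,
    h.leafThrough_saturatedFoliation hr hF,
    fun x => ⟨h.disjoint_span x, h.tangentSpace_saturatedFoliation hr hF x⟩⟩
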